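/- Let $\mathcal G$ be a connected metric graph with finitely many vertices, finitely many bounded edges (each identified with an interval $[0,d]$, $0<d<\infty$) and finitely many half-lines $\ell_1,\dots,\ell_m$ (each identified with $[0,+\infty)$), $m\ge 1$. Let $H^1(\mathcal G)$ be the space of continuous functions $u:\mathcal G\to\mathbb R$ whose restriction to every edge $e$ lies in $H^1(e)$; for $\mu>0$ put $H^1_\mu(\mathcal G)=\{u\in H^1(\mathcal G):\int_{\mathcal G}|u|^2=\mu\}$ and $$E(u,\mathcal G)=\frac12\int_{\mathcal G}|u'|^2-\frac16\int_{\mathcal G}|u|^6 .$$ The critical mass $\mu_{\mathcal F}$ of a metric graph $\mathcal F$ is the largest $m\ge 0$ such that $m^2\|u\|_{L^6(\mathcal F)}^6\le 3\,\|u\|_{L^2(\mathcal F)}^4\|u'\|_{L^2(\mathcal F)}^2$ for all $u\in H^1(\mathcal F)$; $\mu_{\mathbb R}$ is the critical mass of the real line, and $\mathcal G\setminus\ell_i$ is the graph obtained from $\mathcal G$ by removing the half-line $\ell_i$ and its vertex at infinity. Assume that the compact core of $\mathcal G$ is not empty, i.e. $\mathcal G$ has at least one bounded edge, and that $\mu_{\mathcal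 G}=\mu_{\mathbb R}$ and $\mu_{\mathcal G\setminus\ell_i}=\mu_{\mathbb R}$ for every $i=1,\dots,m$. Then there exists $\bar\mu\in(0,\mu_{\mathbb R})$ such that for every $\mu\in(\bar\mu,\mu_{\mathbb R})$ the functional $E(\cdot,\mathcal G)$ has a critical point on $H^1_\mu(\mathcal G)$ which is a local minimizer of $E(\cdot,\mathcal G)$ on $H^1_\mu(\mathcal G)$ (with respect to the $H^1(\mathcal G)$ topology). -/

import Mathlib

open MeasureTheory Set

/-- A metric graph with vertices `V` (all at finite distance), bounded edges `B` and half-lines `L`.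
The bounded edge `b` is a copy of `[0, len b]`, with `0` glued to the vertex `src b` and `len b`
glued to the vertex `tgt b`; self-loops and multiple edges are allowed. The half-line `l` is a copy
of `[0, +∞)`, with `0` glued to the vertex `root l`. -/
structure MetricGraph (V B L : Type*) where
  src : B → V
  tgt : B → V
  len : B → ℝ
  len_pos : ∀ b, 0 < len b
  root : L → V

/-- The Sobolev space `H¹(s)` for a closed interval `s`: functions that are absolutely continuous on
the compact subintervals of `s` and square integrable on `s` together with their derivative (which
exists almost everywhere). Only the values on `s` are relevant. -/
def MemH1On (s : Set ℝ) (f : ℝ → ℝ) : Prop :=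
  (∀ a ∈ s, ∀ b ∈ s, AbsolutelyContinuousOnInterval f a b) ∧
    MemLp f 2 (volume.restrict s) ∧ MemLp (deriv f) 2 (volume.restrict s)

namespace MetricGraph

/-- The real line: two half-lines glued together at the origin. -/
def realLine : MetricGraph Unit Empty Bool where
  src := Empty.elim
  tgt := Empty.elim
  len := Empty.elim
  len_pos := fun b => b.elim
  root := fun _ => ()

variable {V B L : Type*}

/-- The graph is connected: any two vertices are joined by a path of bounded edges. -/
def Connected (G : MetricGraph V B L) : Prop :=
  (SimpleGraph.fromRel (fun v w => ∃ b, G.src b = v ∧ G.tgt b = w)).Connected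

/-- The graph obtained by removing the half-line `l` (with its vertex at infinity). -/
def removeHalfLine (G : MetricGraph V B L) (l : L) : MetricGraph V B {k : L // k ≠ l} where
  src := G.src
  tgt := G.tgt
  len := G.len
  len_pos := G.len_pos
  root := fun k => G.root k.1

/-- The interval with which an edge (bounded edge or half-line) is identified. -/
def edge (G : MetricGraph V B L) : B ⊕ L → Set ℝ
  | Sum.inl b => Icc 0 (G.len b)
  | Sum.inr _ => Ici 0

/-- `H¹(G)`: families of functions, one on each edge, that are `H¹` on every edge and agree at the
vertices, that is, the continuous functions on the graph that are `H¹` on every edge. -/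
def H1 (G : MetricGraph V B L) : Set (B ⊕ L → ℝ → ℝ) :=
  {u | (∀ e, MemH1On (G.edge e) (u e)) ∧
    ∃ h : V → ℝ, (∀ b, u (Sum.inl b) 0 = h (G.src b) ∧ u (Sum.inl b) (G.len b) = h (G.tgt b)) ∧
      ∀ l, u (Sum.inr l) 0 = h (G.root l)}

variable [Fintype B] [Fintype L]

/-- The integral over the graph of a family of functions on the edges. -/
noncomputable def integral (G : MetricGraph V B L) (f : B ⊕ L → ℝ → ℝ) : ℝ :=
  ∑ e, ∫ x in G.edge e, f e x

/-- The mass `∫_G |u|²`. -/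
noncomputable def mass (G : MetricGraph V B L) (u : B ⊕ L → ℝ → ℝ) : ℝ :=
  G.integral (fun e x => |u e x| ^ 2)

/-- The kinetic term `∫_G |u'|²`. -/
noncomputable def kinetic (G : MetricGraph V B L) (u : B ⊕ L → ℝ → ℝ) : ℝ :=
  G.integral (fun e x => |deriv (u e) x| ^ 2)

/-- The term `∫_G |u|⁶`. -/
noncomputable def sextic (G : MetricGraph V B L) (u : B ⊕ L → ℝ → ℝ) : ℝ :=
  G.integral (fun e x => |u e x| ^ 6)

/-- The energy `E(u, G) = (1/2) ∫_G |u'|² - (1/6) ∫_G |u|⁶`. -/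
noncomputable def energy (G : MetricGraph V B L) (u : B ⊕ L → ℝ → ℝ) : ℝ :=
  (1 / 2) * G.kinetic u - (1 / 6) * G.sextic u

/-- The `H¹(G)` norm. -/
noncomputable def h1Norm (G : MetricGraph V B L) (u : B ⊕ L → ℝ → ℝ) : ℝ :=
  Real.sqrt (G.mass u + G.kinetic u)

/-- The critical mass of `G`: the largest `m ≥ 0` for which the Gagliardo-Nirenberg inequality
`‖u‖₆⁶ ≤ (3 / m²) ‖u‖₂⁴ ‖u'‖₂²` holds on `H¹(G)`. It is `0` if the graph is compact with at least
one edge, as constant functions show. -/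
noncomputable def criticalMass (G : MetricGraph V B L) : ℝ :=
  sSup {m : ℝ | 0 ≤ m ∧ ∀ u ∈ G.H1, m ^ 2 * G.sextic u ≤ 3 * G.mass u ^ 2 * G.kinetic u}

/-- The constraint set `H¹_μ(G)`. -/
def H1Mass (G : MetricGraph V B L) (μ : ℝ) : Set (B ⊕ L → ℝ → ℝ) :=
  {u | u ∈ G.H1 ∧ G.mass u = μ}

/-- `u` is a critical point of the energy constrained to `H¹_μ(G)`: the differential of the energy
at `u` vanishes in every direction `φ` tangent to the constraint, that is, `∫_G u φ = 0`. -/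
def IsCriticalPoint (G : MetricGraph V B L) (μ : ℝ) (u : B ⊕ L → ℝ → ℝ) : Prop :=
  u ∈ G.H1Mass μ ∧ ∀ φ ∈ G.H1, G.integral (fun e x => u e x * φ e x) = 0 →
    HasDerivAt (fun t : ℝ => G.energy (u + t • φ)) 0 0

/-- `u` is a local minimizer of the energy constrained to `H¹_μ(G)`, in the `H¹(G)` topology. -/
def IsLocalMinimizer (G : MetricGraph V B L) (μ : ℝ) (u : B ⊕ L → ℝ → ℝ) : Prop :=
  u ∈ G.H1Mass μ ∧
    ∃ ε : ℝ, 0 < ε ∧ ∀ w ∈ G.H1Mass μ, G.h1Norm (w - u) < ε → G.energy u ≤ G.energy w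

end MetricGraph

/-! Write `m = lineMass`, and `M`, `T`, `S` for the mass, the kinetic term and the sextic term, so
that `E = T / 2 - S / 6`. The local minimizer is an absolute minimizer of `E` over the set
`G.confined μ K`: mass `μ`, at most `m / 3` on each half-line, `T ≥ K`. Here `K` depends on the
graph alone, and both constraints turn out to be inactive at the minimizer.

The energy is high on the boundary of this set. A half-line, reflected evenly, has half the critical
mass of the line, so one carrying at most `m / 3` satisfies `S ≤ 4 / 3 * T`. If it carries exactly
`m / 3`, the rest of the graph has mass at most `2 * m / 3` and, by assumption, critical mass `m`,
so it obeys the same inequality; hence `E ≥ 5 / 18 * T > K / 4` (`sextic_le_of_mass_eq_third`). If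
`T` is at most a small `K`, the function is uniformly small on the compact core, whose sextic term
is then at most `T / 6`; hence `S ≤ 3 / 2 * T` and `E ≥ T / 4` (`exists_kinetic_barrier`).

Inside, the energy falls below `K / 4` once `μ` is close to `m`: a soliton of the line, truncated
and compressed into one bounded edge, has mass `μ`, large `T` and energy near `0`
(`exists_concentrated`). This needs `m ≥ √3 * π / 2`, the mass of the soliton, which is Nagy's sharp
inequality (`nagy`).

The infimum is attained (`exists_minimizer`). Since `μ < m = μ_G`, minimizing sequences are bounded
in `H¹`. Mass may escape along half-lines, but tails of mass at most `m / 3` satisfy `E ≥ 5 / 18 *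
T`, so both `E` and `E - 5 / 18 * T` are lower semicontinuous along the sequence. The second
functional keeps `T ≥ K` in the limit. The limit then has `S > 3 / 2 * T`, so multiplying it by a
constant larger than `1` to restore lost mass would lower the energy further. Hence no mass is lost.

A local minimizer is a critical point: differentiate the energy along a curve renormalized to mass
`μ`. -/

open Filter Topology

/-! ### Integrals of an `H¹` function over an edge -/

/-- The mass of `f` on `s`. -/
noncomputable def massOn (s : Set ℝ) (f : ℝ → ℝ) : ℝ := ∫ x in s, |f x| ^ 2

/-- The kinetic term of `f` on `s`. -/
noncomputable def kineticOn (s : Set ℝ) (f : ℝ → ℝ) : ℝ := ∫ x in s, |deriv f x| ^ 2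

/-- The sextic term of `f` on `s`. -/
noncomputable def sexticOn (s : Set ℝ) (f : ℝ → ℝ) : ℝ := ∫ x in s, |f x| ^ 6

/-- The intervals with which the edges of a metric graph are identified. -/
def IsEdge (s : Set ℝ) : Prop := (∃ d, 0 < d ∧ s = Icc 0 d) ∨ s = Ici 0

/-- Every point of `s` lies in an interval of length `d` contained in `s`. -/
def HasWidth (s : Set ℝ) (d : ℝ) : Prop := ∀ x ∈ s, ∃ a, a ≤ x ∧ x ≤ a + d ∧ Icc a (a + d) ⊆ s

theorem isEdge_Icc {d : ℝ} (hd : 0 < d) : IsEdge (Icc 0 d) := Or.inl ⟨d, hd, rfl⟩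

theorem isEdge_Ici : IsEdge (Ici 0) := Or.inr rfl

theorem MetricGraph.isEdge {V B L : Type*} (G : MetricGraph V B L) (e : B ⊕ L) :
    IsEdge (G.edge e) := by
  cases e with
  | inl b => exact isEdge_Icc (G.len_pos b)
  | inr l => exact isEdge_Ici

theorem hasWidth_Icc (d : ℝ) : HasWidth (Icc 0 d) d := fun x hx =>
  ⟨0, hx.1, by simpa using hx.2, by simp⟩

theorem hasWidth_Ici (d : ℝ) (hd : 0 ≤ d) : HasWidth (Ici 0) d := fun x hx =>
  ⟨x, le_rfl, by linarith, fun _ hy => le_trans hx hy.1⟩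

namespace IsEdge

variable {s : Set ℝ}

theorem exists_hasWidth (hs : IsEdge s) : ∃ d, 0 < d ∧ HasWidth s d := by
  rcases hs with ⟨d, hd, rfl⟩ | rfl
  · exact ⟨d, hd, hasWidth_Icc d⟩
  · exact ⟨1, one_pos, hasWidth_Ici 1 zero_le_one⟩

theorem ordConnected (hs : IsEdge s) : s.OrdConnected := by
  rcases hs with ⟨d, hd, rfl⟩ | rfl
  · exact ordConnected_Icc
  · exact ordConnected_Ici

theorem measurableSet (hs : IsEdge s) : MeasurableSet s := hs.ordConnected.measurableSet

theorem zero_mem (hs : IsEdge s) : (0 : ℝ) ∈ s := by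
  rcases hs with ⟨d, hd, rfl⟩ | rfl
  · exact ⟨le_rfl, hd.le⟩
  · exact self_mem_Ici

theorem nonneg (hs : IsEdge s) {x : ℝ} (hx : x ∈ s) : 0 ≤ x := by
  rcases hs with ⟨d, hd, rfl⟩ | rfl
  · exact hx.1
  · exact hx

theorem uIcc_subset (hs : IsEdge s) {a b : ℝ} (ha : a ∈ s) (hb : b ∈ s) : uIcc a b ⊆ s :=
  hs.ordConnected.uIcc_subset ha hb

/-- Almost every point of an edge lies in its interior. -/
theorem ae_mem_nhds (hs : IsEdge s) : ∀ᵐ x ∂(volume.restrict s), s ∈ 𝓝 x := by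
  rw [ae_restrict_iff' hs.measurableSet]
  rcases hs with ⟨d, hd, rfl⟩ | rfl
  · have h1 : ∀ᵐ x : ℝ, x ≠ 0 := by simp [ae_iff, measure_singleton]
    have h2 : ∀ᵐ x : ℝ, x ≠ d := by simp [ae_iff, measure_singleton]
    filter_upwards [h1, h2] with x h1 h2 hx
    exact Icc_mem_nhds (lt_of_le_of_ne hx.1 (Ne.symm h1)) (lt_of_le_of_ne hx.2 h2)
  · have h1 : ∀ᵐ x : ℝ, x ≠ 0 := by simp [ae_iff, measure_singleton]
    filter_upwards [h1] with x h1 hx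
    exact Ici_mem_nhds (lt_of_le_of_ne hx (Ne.symm h1))

/-- A property that holds almost everywhere on every segment `[0, x]` of an edge holds almost
everywhere on the edge. -/
theorem ae_of_forall_uIcc (hs : IsEdge s) {p : ℝ → Prop}
    (h : ∀ b ∈ s, ∀ᵐ x, x ∈ uIcc 0 b → p x) : ∀ᵐ x ∂(volume.restrict s), p x := by
  rw [ae_restrict_iff' hs.measurableSet]
  rcases hs with ⟨d, hd, rfl⟩ | rfl
  · filter_upwards [h d ⟨hd.le, le_rfl⟩] with x hx hxs
    exact hx (by rwa [uIcc_of_le hd.le])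
  · have : ∀ᵐ x, ∀ n : ℕ, x ∈ uIcc (0 : ℝ) n → p x :=
      ae_all_iff.2 fun n => h n (mem_Ici.2 n.cast_nonneg)
    filter_upwards [this] with x hx hxs
    obtain ⟨n, hn⟩ := exists_nat_ge x
    exact hx n (by rw [uIcc_of_le n.cast_nonneg]; exact ⟨hxs, hn⟩)

end IsEdge

/-! ### Absolute continuity -/

theorem AbsolutelyContinuousOnInterval.congr {f g : ℝ → ℝ} {a b : ℝ}
    (hf : AbsolutelyContinuousOnInterval f a b) (h : EqOn f g (uIcc a b)) :
    AbsolutelyContinuousOnInterval g a b := by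
  rw [absolutelyContinuousOnInterval_iff] at hf ⊢
  intro ε hε
  obtain ⟨δ, hδ, H⟩ := hf ε hε
  refine ⟨δ, hδ, fun E hE hlt => ?_⟩
  have := H E hE hlt
  rwa [Finset.sum_congr rfl fun i hi => by rw [h (hE.1 i hi).1, h (hE.1 i hi).2]] at this

theorem AbsolutelyContinuousOnInterval.lipschitz_comp {f W : ℝ → ℝ} {a b : ℝ} {K : ℝ} {t : Set ℝ}
    (hf : AbsolutelyContinuousOnInterval f a b) (hft : MapsTo f (uIcc a b) t) (hK : 0 ≤ K)
    (hW : ∀ x ∈ t, ∀ y ∈ t, |W x - W y| ≤ K * |x - y|) :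
    AbsolutelyContinuousOnInterval (fun x => W (f x)) a b := by
  rw [absolutelyContinuousOnInterval_iff] at hf ⊢
  intro ε hε
  obtain ⟨δ, hδ, H⟩ := hf (ε / (K + 1)) (by positivity)
  refine ⟨δ, hδ, fun E hE hlt => ?_⟩
  calc _ ≤ ∑ i ∈ Finset.range E.1, K * dist (f (E.2 i).1) (f (E.2 i).2) :=
        Finset.sum_le_sum fun i hi => hW _ (hft (hE.1 i hi).1) _ (hft (hE.1 i hi).2)
    _ = K * ∑ i ∈ Finset.range E.1, dist (f (E.2 i).1) (f (E.2 i).2) := by rw [Finset.mul_sum]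
    _ ≤ K * (ε / (K + 1)) := by gcongr; exact (H E hE hlt).le
    _ < (K + 1) * (ε / (K + 1)) := by gcongr; linarith
    _ = ε := by field_simp

/-! ### The Cauchy-Schwarz inequality -/

theorem MeasureTheory.MemLp.integrable_mul_of_two {μ : Measure ℝ} {f g : ℝ → ℝ}
    (hf : MemLp f 2 μ) (hg : MemLp g 2 μ) : Integrable (fun x => f x * g x) μ :=
  hf.integrable_mul hg

/-- The quadratic `t ↦ ∫ (t * g + f) ^ 2` is nonnegative, so its discriminant is nonpositive. -/
theorem sq_integral_mul_le {μ : Measure ℝ} {f g : ℝ → ℝ}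
    (hf : MemLp f 2 μ) (hg : MemLp g 2 μ) :
    (∫ x, f x * g x ∂μ) ^ 2 ≤ (∫ x, f x ^ 2 ∂μ) * ∫ x, g x ^ 2 ∂μ := by
  have hff := hf.integrable_sq
  have hgg := hg.integrable_sq
  have hfg := hf.integrable_mul_of_two hg
  have key : ∀ t : ℝ, 0 ≤ (∫ x, g x ^ 2 ∂μ) * (t * t) + (2 * ∫ x, f x * g x ∂μ) * t
      + ∫ x, f x ^ 2 ∂μ := by
    intro t
    have : ∫ x, (t * g x + f x) ^ 2 ∂μ = (∫ x, g x ^ 2 ∂μ) * (t * t)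
        + (2 * ∫ x, f x * g x ∂μ) * t + ∫ x, f x ^ 2 ∂μ := by
      have e : (fun x => (t * g x + f x) ^ 2)
          = fun x => ((t * t) * g x ^ 2 + (2 * t) * (f x * g x)) + f x ^ 2 := by
        funext x; ring
      have hsum : Integrable (fun x => (t * t) * g x ^ 2 + (2 * t) * (f x * g x)) μ :=
        (hgg.const_mul _).add (hfg.const_mul _)
      rw [e, integral_add hsum hff, integral_add (hgg.const_mul _) (hfg.const_mul _),
        integral_const_mul, integral_const_mul]
      ring
    rw [← this]
    exact integral_nonneg fun x => sq_nonneg _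
  have := discrim_le_zero key
  rw [discrim] at this
  nlinarith

theorem sq_intervalIntegral_le {g : ℝ → ℝ} {a b : ℝ} (hab : a ≤ b)
    (hg : MemLp g 2 (volume.restrict (Icc a b))) :
    (∫ x in a..b, g x) ^ 2 ≤ (b - a) * ∫ x in Icc a b, |g x| ^ 2 := by
  have h1 : MemLp (fun _ : ℝ => (1 : ℝ)) 2 (volume.restrict (Icc a b)) := memLp_const 1
  have := sq_integral_mul_le h1 hg
  rw [intervalIntegral.integral_of_le hab, ← integral_Icc_eq_integral_Ioc]
  simpa [hab, sq_abs] using this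

/-! ### Functions in `H¹` of an edge -/

theorem deriv_smul_eq (c : ℝ) (f : ℝ → ℝ) : deriv (c • f) = c • deriv f :=
  funext fun _ => deriv_const_smul_field c f

namespace MemH1On

variable {s : Set ℝ} {f g : ℝ → ℝ}

theorem ac (hf : MemH1On s f) {a b : ℝ} (ha : a ∈ s) (hb : b ∈ s) :
    AbsolutelyContinuousOnInterval f a b := hf.1 a ha b hb

theorem memLp (hf : MemH1On s f) : MemLp f 2 (volume.restrict s) := hf.2.1

theorem memLp_deriv (hf : MemH1On s f) : MemLp (deriv f) 2 (volume.restrict s) := hf.2.2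

theorem ae_differentiableAt (hs : IsEdge s) (hf : MemH1On s f) :
    ∀ᵐ x ∂(volume.restrict s), DifferentiableAt ℝ f x :=
  hs.ae_of_forall_uIcc fun _ hb => (hf.ac hs.zero_mem hb).ae_differentiableAt

theorem integrableOn_sq (hf : MemH1On s f) : IntegrableOn (fun x => |f x| ^ 2) s := by
  simpa only [sq_abs, IntegrableOn] using hf.memLp.integrable_sq

theorem integrableOn_deriv_sq (hf : MemH1On s f) : IntegrableOn (fun x => |deriv f x| ^ 2) s := by
  simpa only [sq_abs, IntegrableOn] using hf.memLp_deriv.integrable_sq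

theorem intervalIntegral_deriv (hf : MemH1On s f) {a b : ℝ} (ha : a ∈ s) (hb : b ∈ s) :
    ∫ x in a..b, deriv f x = f b - f a := (hf.ac ha hb).integral_deriv_eq_sub

theorem sq_sub_le (hs : IsEdge s) (hf : MemH1On s f) {a b : ℝ} (ha : a ∈ s) (hb : b ∈ s)
    (hab : a ≤ b) : (f b - f a) ^ 2 ≤ (b - a) * kineticOn s f := by
  have hsub : Icc a b ⊆ s := by simpa [uIcc_of_le hab] using hs.uIcc_subset ha hb
  rw [← hf.intervalIntegral_deriv ha hb]
  refine (sq_intervalIntegral_le hab (hf.memLp_deriv.mono_measure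
    (Measure.restrict_mono hsub le_rfl))).trans ?_
  refine mul_le_mul_of_nonneg_left ?_ (sub_nonneg.2 hab)
  exact setIntegral_mono_set hf.integrableOn_deriv_sq
    (Eventually.of_forall fun x => by positivity) (Eventually.of_forall hsub)

theorem abs_sub_le (hs : IsEdge s) (hf : MemH1On s f) {a b : ℝ} (ha : a ∈ s) (hb : b ∈ s) :
    |f b - f a| ≤ √(|b - a| * kineticOn s f) := by
  apply Real.le_sqrt_of_sq_le
  rw [sq_abs]
  rcases le_total a b with h | h
  · rw [abs_of_nonneg (sub_nonneg.2 h)]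
    exact hf.sq_sub_le hs ha hb h
  · rw [abs_of_nonpos (sub_nonpos.2 h), ← neg_sub (f a), neg_sq, neg_sub]
    exact hf.sq_sub_le hs hb ha h

theorem continuousOn (hs : IsEdge s) (hf : MemH1On s f) : ContinuousOn f s := by
  intro a ha
  rw [ContinuousWithinAt, tendsto_iff_dist_tendsto_zero]
  have h0 : Tendsto (fun b => √(|b - a| * kineticOn s f)) (𝓝[s] a) (𝓝 0) := by
    have : Continuous fun b => √(|b - a| * kineticOn s f) := by fun_prop
    simpa using (this.tendsto a).mono_left nhdsWithin_le_nhds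
  refine squeeze_zero' (Eventually.of_forall fun _ => dist_nonneg) ?_ h0
  filter_upwards [self_mem_nhdsWithin] with b hb
  exact hf.abs_sub_le hs ha hb

theorem add (hs : IsEdge s) (hf : MemH1On s f) (hg : MemH1On s g) : MemH1On s (f + g) := by
  refine ⟨fun a ha b hb => (hf.ac ha hb).add (hg.ac ha hb), hf.memLp.add hg.memLp,
    (hf.memLp_deriv.add hg.memLp_deriv).ae_eq ?_⟩
  filter_upwards [hf.ae_differentiableAt hs, hg.ae_differentiableAt hs] with x h1 h2
  rw [deriv_add h1 h2]; rfl

theorem const_smul (hf : MemH1On s f) (c : ℝ) : MemH1On s (c • f) := by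
  refine ⟨fun a ha b hb => (hf.ac ha hb).const_smul c, hf.memLp.const_smul c, ?_⟩
  rw [deriv_smul_eq]
  exact hf.memLp_deriv.const_smul c

theorem of_contDiff (hf : ContDiff ℝ 1 f) (h1 : MemLp f 2 (volume.restrict s))
    (h2 : MemLp (deriv f) 2 (volume.restrict s)) : MemH1On s f :=
  ⟨fun _ _ _ _ => hf.contDiffOn.absolutelyContinuousOnInterval, h1, h2⟩

theorem of_contDiff_Icc {d : ℝ} (hf : ContDiff ℝ 1 f) : MemH1On (Icc 0 d) f := by
  have aux : ∀ g : ℝ → ℝ, Continuous g → MemLp g 2 (volume.restrict (Icc 0 d)) := by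
    intro g hg
    rw [memLp_two_iff_integrable_sq hg.aestronglyMeasurable]
    exact (hg.pow 2).continuousOn.integrableOn_Icc
  exact of_contDiff hf (aux f hf.continuous) (aux _ (hf.continuous_deriv le_rfl))

end MemH1On

theorem MeasureTheory.MemLp.intervalIntegrable_of_isEdge {s : Set ℝ} {g : ℝ → ℝ} (hs : IsEdge s)
    (hg : MemLp g 2 (volume.restrict s)) {a b : ℝ} (ha : a ∈ s) (hb : b ∈ s) :
    IntervalIntegrable g volume a b := by
  rw [intervalIntegrable_iff]
  have hsub : uIoc a b ⊆ s := uIoc_subset_uIcc.trans (hs.uIcc_subset ha hb)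
  have : IsFiniteMeasure (volume.restrict (uIoc a b)) :=
    isFiniteMeasure_restrict.2 (by simp [uIoc])
  exact (hg.mono_measure (Measure.restrict_mono hsub le_rfl)).integrable one_le_two

/-- The primitive of a square integrable function is absolutely continuous, and its derivative is
that function almost everywhere. -/
theorem ac_and_deriv_of_primitive {s : Set ℝ} {f g : ℝ → ℝ} {c : ℝ} (hs : IsEdge s)
    (hg : MemLp g 2 (volume.restrict s)) (hf : ∀ x ∈ s, f x = c + ∫ t in (0 : ℝ)..x, g t) :
    (∀ a ∈ s, ∀ b ∈ s, AbsolutelyContinuousOnInterval f a b) ∧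
      deriv f =ᵐ[volume.restrict s] g := by
  constructor
  · intro a ha b hb
    have hi := hg.intervalIntegrable_of_isEdge hs ha hb
    have h1 := hi.absolutelyContinuousOnInterval_intervalIntegral (c := a) left_mem_uIcc
    have h2 : AbsolutelyContinuousOnInterval (fun _ : ℝ => f a) a b :=
      contDiff_const.contDiffOn.absolutelyContinuousOnInterval
    refine (h2.add h1).congr fun x hx => ?_
    have hxs := hs.uIcc_subset ha hb hx
    simp only [Pi.add_apply]
    rw [hf x hxs, hf a ha, add_assoc, intervalIntegral.integral_add_adjacent_intervals
      (hg.intervalIntegrable_of_isEdge hs hs.zero_mem ha)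
      (hg.intervalIntegrable_of_isEdge hs ha hxs)]
  · have h1 : ∀ᵐ x ∂(volume.restrict s), HasDerivAt (fun x => ∫ t in (0 : ℝ)..x, g t) (g x) x := by
      refine hs.ae_of_forall_uIcc fun b hb => ?_
      filter_upwards [(hg.intervalIntegrable_of_isEdge hs hs.zero_mem hb).ae_hasDerivAt_integral]
        with x hx hxb
      exact hx hxb 0 left_mem_uIcc
    filter_upwards [h1, hs.ae_mem_nhds] with x hx hxs
    have : f =ᶠ[𝓝 x] fun x => c + ∫ t in (0 : ℝ)..x, g t := by
      filter_upwards [hxs] with y hy using hf y hy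
    exact ((hx.const_add c).congr_of_eventuallyEq this).deriv

theorem MemH1On.of_primitive {s : Set ℝ} {f g : ℝ → ℝ} {c : ℝ} (hs : IsEdge s)
    (hg : MemLp g 2 (volume.restrict s)) (hf : ∀ x ∈ s, f x = c + ∫ t in (0 : ℝ)..x, g t)
    (hf2 : MemLp f 2 (volume.restrict s)) : MemH1On s f :=
  ⟨(ac_and_deriv_of_primitive hs hg hf).1, hf2,
    hg.ae_eq (ac_and_deriv_of_primitive hs hg hf).2.symm⟩

/-! ### Integrals over an edge -/

theorem massOn_nonneg (s : Set ℝ) (f : ℝ → ℝ) : 0 ≤ massOn s f :=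
  integral_nonneg fun _ => by positivity

theorem kineticOn_nonneg (s : Set ℝ) (f : ℝ → ℝ) : 0 ≤ kineticOn s f :=
  integral_nonneg fun _ => by positivity

theorem sexticOn_nonneg (s : Set ℝ) (f : ℝ → ℝ) : 0 ≤ sexticOn s f :=
  integral_nonneg fun _ => by positivity

theorem massOn_smul (s : Set ℝ) (c : ℝ) (f : ℝ → ℝ) : massOn s (c • f) = c ^ 2 * massOn s f := by
  simp [massOn, ← integral_const_mul, abs_mul, mul_pow]

theorem kineticOn_smul (s : Set ℝ) (c : ℝ) (f : ℝ → ℝ) :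
    kineticOn s (c • f) = c ^ 2 * kineticOn s f := by
  simp only [kineticOn, deriv_smul_eq, ← integral_const_mul, sq_abs, Pi.smul_apply, smul_eq_mul,
    mul_pow]

theorem sexticOn_smul (s : Set ℝ) (c : ℝ) (f : ℝ → ℝ) :
    sexticOn s (c • f) = c ^ 6 * sexticOn s f := by
  have : (|c|) ^ 6 = c ^ 6 := Even.pow_abs (by decide) c
  simp [sexticOn, ← integral_const_mul, abs_mul, mul_pow, this]

namespace MemH1On

variable {s : Set ℝ} {f g : ℝ → ℝ}

/-- On an interval of length `d` around `x`, some point has `|f| ^ 2` at most its average, and the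
oscillation of `f` is controlled by the kinetic term. On a half-line `d` is free and can be adapted
to the function. -/
theorem abs_le (hs : IsEdge s) {d : ℝ} (hd : 0 < d) (hw : HasWidth s d) (hf : MemH1On s f)
    {x : ℝ} (hx : x ∈ s) : |f x| ≤ √(massOn s f / d) + √(d * kineticOn s f) := by
  obtain ⟨a, ha, hb, hI⟩ := hw x hx
  have hvol : volume (Icc a (a + d)) = ENNReal.ofReal d := by rw [Real.volume_Icc]; simp
  obtain ⟨y, hy, hle⟩ := exists_le_setAverage (μ := volume) (s := Icc a (a + d))
    (f := fun x => |f x| ^ 2) (by simp [hvol, hd]) (by simp [hvol])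
    (hf.integrableOn_sq.mono_set hI)
  have hm : ∫ x in Icc a (a + d), |f x| ^ 2 ≤ massOn s f :=
    setIntegral_mono_set hf.integrableOn_sq
      (Eventually.of_forall fun x => by positivity) (Eventually.of_forall hI)
  have h1 : |f y| ≤ √(massOn s f / d) := by
    apply Real.le_sqrt_of_sq_le
    refine hle.trans ?_
    rw [setAverage_eq, measureReal_def, hvol, ENNReal.toReal_ofReal hd.le, smul_eq_mul,
      div_eq_inv_mul]
    gcongr
  have h2 : |f x - f y| ≤ √(d * kineticOn s f) := by
    refine (hf.abs_sub_le hs (hI hy) hx).trans (Real.sqrt_le_sqrt ?_)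
    refine mul_le_mul_of_nonneg_right ?_ (kineticOn_nonneg _ _)
    rw [_root_.abs_le]
    constructor <;> linarith [hy.1, hy.2]
  calc |f x| = |f y + (f x - f y)| := by ring_nf
    _ ≤ |f y| + |f x - f y| := abs_add_le _ _
    _ ≤ _ := add_le_add h1 h2

theorem exists_bound (hs : IsEdge s) (hf : MemH1On s f) : ∃ C, 0 ≤ C ∧ ∀ x ∈ s, |f x| ≤ C := by
  obtain ⟨d, hd, hw⟩ := hs.exists_hasWidth
  exact ⟨_, by positivity, fun x hx => hf.abs_le hs hd hw hx⟩

theorem aestronglyMeasurable (hf : MemH1On s f) : AEStronglyMeasurable f (volume.restrict s) :=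
  hf.memLp.1

/-- Products of six factors taken from two `H¹` functions are integrable. -/
theorem integrableOn_pow_mul_pow (hs : IsEdge s) (hf : MemH1On s f) (hg : MemH1On s g) {i j : ℕ}
    (hij : i + j = 6) : IntegrableOn (fun x => f x ^ i * g x ^ j) s := by
  obtain ⟨C, hC, hfC⟩ := hf.exists_bound hs
  obtain ⟨D, hD, hgD⟩ := hg.exists_bound hs
  have hint : IntegrableOn (fun x => (C + D) ^ 4 * (2 * (|f x| ^ 2 + |g x| ^ 2))) s :=
    ((hf.integrableOn_sq.add hg.integrableOn_sq).const_mul 2).const_mul _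
  refine hint.mono' ((hf.aestronglyMeasurable.pow i).mul (hg.aestronglyMeasurable.pow j)) ?_
  refine (ae_restrict_iff' hs.measurableSet).2 (Eventually.of_forall fun x hx => ?_)
  have h1 : |f x| ≤ |f x| + |g x| := le_add_of_nonneg_right (abs_nonneg _)
  have h2 : |g x| ≤ |f x| + |g x| := le_add_of_nonneg_left (abs_nonneg _)
  calc ‖f x ^ i * g x ^ j‖ = |f x| ^ i * |g x| ^ j := by simp
    _ ≤ (|f x| + |g x|) ^ i * (|f x| + |g x|) ^ j := by gcongr
    _ = (|f x| + |g x|) ^ 4 * (|f x| + |g x|) ^ 2 := by rw [← pow_add, ← pow_add, hij]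
    _ ≤ (C + D) ^ 4 * (2 * (|f x| ^ 2 + |g x| ^ 2)) := by
        gcongr
        · exact hfC x hx
        · exact hgD x hx
        · nlinarith [sq_nonneg (|f x| - |g x|)]

theorem integrableOn_sextic (hs : IsEdge s) (hf : MemH1On s f) :
    IntegrableOn (fun x => |f x| ^ 6) s := by
  have := hf.integrableOn_pow_mul_pow hs hf (i := 6) (j := 0) rfl
  simpa [Even.pow_abs (show Even 6 by decide)] using this

theorem integrableOn_mul (hf : MemH1On s f) (hg : MemH1On s g) :
    IntegrableOn (fun x => f x * g x) s := hf.memLp.integrable_mul_of_two hg.memLp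

end MemH1On

/-! ### Translation of a function on the half-line -/

section Shift

variable {f : ℝ → ℝ} {R : ℝ}

theorem measurePreserving_add_right_Ici (R : ℝ) :
    MeasurePreserving (fun x : ℝ => x + R) (volume.restrict (Ici 0)) (volume.restrict (Ici R)) := by
  have := (measurePreserving_add_right (volume : Measure ℝ) R).restrict_preimage
    (measurableSet_Ici (a := R))
  simpa using this

theorem setIntegral_Ici_comp_add (F : ℝ → ℝ) (R : ℝ) :
    ∫ x in Ici 0, F (x + R) = ∫ x in Ici R, F x :=
  (measurePreserving_add_right_Ici R).integral_comp (measurableEmbedding_addRight R) F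

theorem MemH1On.comp_add_right (hf : MemH1On (Ici 0) f) (hR : 0 ≤ R) :
    MemH1On (Ici 0) (fun x => f (x + R)) := by
  have hsub : Ici R ⊆ Ici (0 : ℝ) := Ici_subset_Ici.2 hR
  have h1 : ∀ g : ℝ → ℝ, MemLp g 2 (volume.restrict (Ici 0)) →
      MemLp (fun x => g (x + R)) 2 (volume.restrict (Ici 0)) := fun g hg =>
    (hg.mono_measure (Measure.restrict_mono hsub le_rfl)).comp_measurePreserving
      (measurePreserving_add_right_Ici R)
  refine MemH1On.of_primitive (c := f R) isEdge_Ici (h1 _ hf.memLp_deriv) (fun x hx => ?_)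
    (h1 _ hf.memLp)
  rw [intervalIntegral.integral_comp_add_right (fun t => deriv f t),
    hf.intervalIntegral_deriv (hsub (by simp)) (hsub (by simpa using hx))]
  simp

theorem massOn_comp_add (f : ℝ → ℝ) (R : ℝ) :
    massOn (Ici 0) (fun x => f (x + R)) = massOn (Ici R) f :=
  setIntegral_Ici_comp_add (fun x => |f x| ^ 2) R

theorem sexticOn_comp_add (f : ℝ → ℝ) (R : ℝ) :
    sexticOn (Ici 0) (fun x => f (x + R)) = sexticOn (Ici R) f :=
  setIntegral_Ici_comp_add (fun x => |f x| ^ 6) R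

theorem kineticOn_comp_add (f : ℝ → ℝ) (R : ℝ) :
    kineticOn (Ici 0) (fun x => f (x + R)) = kineticOn (Ici R) f := by
  have := setIntegral_Ici_comp_add (fun x => |deriv f x| ^ 2) R
  simpa [kineticOn, deriv_comp_add_const] using this

end Shift

/-! ### Behaviour at infinity on the half-line -/

theorem setIntegral_Ici_eq_add {F : ℝ → ℝ} (hF : IntegrableOn F (Ici 0)) {R : ℝ} (hR : 0 ≤ R) :
    ∫ x in Ici 0, F x = (∫ x in Icc 0 R, F x) + ∫ x in Ici R, F x := by
  rw [integral_Icc_eq_integral_Ico, ← setIntegral_union (by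
    rw [Set.disjoint_left]; intro x hx hx'; exact absurd hx.2 (not_lt.2 hx')) measurableSet_Ici
    (hF.mono_set fun x hx => hx.1) (hF.mono_set (Ici_subset_Ici.2 hR)), Ico_union_Ici_eq_Ici hR]

theorem tendsto_setIntegral_Icc_atTop {F : ℝ → ℝ} (hF : IntegrableOn F (Ici 0)) :
    Tendsto (fun R => ∫ x in Icc 0 R, F x) atTop (𝓝 (∫ x in Ici 0, F x)) := by
  rw [integral_Ici_eq_integral_Ioi]
  refine (intervalIntegral_tendsto_integral_Ioi 0 (hF.mono_set Ioi_subset_Ici_self)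
    tendsto_id).congr' ?_
  filter_upwards [eventually_ge_atTop 0] with R hR
  rw [id, intervalIntegral.integral_of_le hR, integral_Icc_eq_integral_Ioc]

theorem tendsto_setIntegral_Ici_atTop {F : ℝ → ℝ} (hF : IntegrableOn F (Ici 0)) :
    Tendsto (fun R => ∫ x in Ici R, F x) atTop (𝓝 0) := by
  have h := (tendsto_setIntegral_Icc_atTop hF).const_sub (∫ x in Ici 0, F x)
  rw [sub_self] at h
  refine h.congr' ?_
  filter_upwards [eventually_ge_atTop 0] with R hR
  rw [setIntegral_Ici_eq_add hF hR]; ring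

/-- The bound `abs_le` with width `1`, applied to the translate of `f` by `R`, estimates `|f R|` by
the mass and kinetic term of the tail, and both vanish as `R → ∞`. -/
theorem MemH1On.tendsto_zero {f : ℝ → ℝ} (hf : MemH1On (Ici 0) f) : Tendsto f atTop (𝓝 0) := by
  rw [tendsto_zero_iff_abs_tendsto_zero]
  have h1 : Tendsto (fun R => √(massOn (Ici R) f) + √(kineticOn (Ici R) f)) atTop (𝓝 0) := by
    have := ((tendsto_setIntegral_Ici_atTop hf.integrableOn_sq).sqrt).add
      (tendsto_setIntegral_Ici_atTop hf.integrableOn_deriv_sq).sqrt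
    simpa [massOn, kineticOn] using this
  refine squeeze_zero' (Eventually.of_forall fun _ => abs_nonneg _) ?_ h1
  filter_upwards [eventually_ge_atTop 0] with R hR
  have := (hf.comp_add_right hR).abs_le isEdge_Ici one_pos (hasWidth_Ici 1 zero_le_one)
    (x := 0) self_mem_Ici
  simpa [massOn_comp_add, kineticOn_comp_add] using this

/-! ### The sharp Gagliardo-Nirenberg inequality on the line -/

/-- The slope `s √(a⁴ - s⁴)` of the soliton of height `a` at height `s`. -/
noncomputable def solitonSlope (a s : ℝ) : ℝ := s * √(a ^ 4 - s ^ 4)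

/-- The primitive of `solitonSlope a`. -/
noncomputable def solitonPrimitive (a s : ℝ) : ℝ := 1 / 2 * ∫ σ in (0 : ℝ)..s ^ 2, √(a ^ 4 - σ ^ 2)

theorem continuous_solitonSlope (a : ℝ) : Continuous (solitonSlope a) := by
  unfold solitonSlope; fun_prop

theorem hasDerivAt_solitonPrimitive (a s : ℝ) :
    HasDerivAt (solitonPrimitive a) (solitonSlope a s) s := by
  have hc : Continuous fun σ : ℝ => √(a ^ 4 - σ ^ 2) := by fun_prop
  have h1 := (intervalIntegral.integral_hasDerivAt_right (hc.intervalIntegrable 0 (s ^ 2))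
    hc.stronglyMeasurable.stronglyMeasurableAtFilter hc.continuousAt)
  have h2 := (HasDerivAt.comp (h₂ := fun u => ∫ σ in (0 : ℝ)..u, √(a ^ 4 - σ ^ 2))
    (h := fun s : ℝ => s ^ 2) s h1 (hasDerivAt_pow 2 s)).const_mul (1 / 2)
  convert! h2 using 1
  simp only [solitonSlope, ← pow_mul]
  norm_num; ring

theorem continuous_solitonPrimitive (a : ℝ) : Continuous (solitonPrimitive a) :=
  continuous_iff_continuousAt.2 fun s => (hasDerivAt_solitonPrimitive a s).continuousAt

theorem solitonPrimitive_abs (a s : ℝ) : solitonPrimitive a |s| = solitonPrimitive a s := by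
  simp [solitonPrimitive]

theorem solitonPrimitive_zero (a : ℝ) : solitonPrimitive a 0 = 0 := by simp [solitonPrimitive]

theorem integral_zero_one_sqrt_one_sub_sq : ∫ x in (0 : ℝ)..1, √(1 - x ^ 2) = Real.pi / 4 := by
  have hc : Continuous fun x : ℝ => √(1 - x ^ 2) := by fun_prop
  have h1 := intervalIntegral.integral_add_adjacent_intervals
    (hc.intervalIntegrable (μ := volume) (-1) 0) (hc.intervalIntegrable (μ := volume) 0 1)
  have h2 : ∫ x in (-1 : ℝ)..0, √(1 - x ^ 2) = ∫ x in (0 : ℝ)..1, √(1 - x ^ 2) := by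
    have := intervalIntegral.integral_comp_neg (a := 0) (b := 1) fun x : ℝ => √(1 - x ^ 2)
    simpa using this.symm
  rw [integral_sqrt_one_sub_sq, h2] at h1
  linarith

/-- The substitution `σ = a ^ 2 * x` turns the integral into the area of a quarter disc; this is
where `π` enters the sharp constant. -/
theorem solitonPrimitive_self (a : ℝ) :
    solitonPrimitive a a = a ^ 4 * Real.pi / 8 := by
  have h := intervalIntegral.mul_integral_comp_mul_left (a := 0) (b := 1) (a ^ 2)
    (f := fun σ : ℝ => √(a ^ 4 - σ ^ 2))
  rw [mul_zero, mul_one] at h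
  have h2 : ∀ x : ℝ, √(a ^ 4 - (a ^ 2 * x) ^ 2) = a ^ 2 * √(1 - x ^ 2) := fun x => by
    rw [show a ^ 4 - (a ^ 2 * x) ^ 2 = (a ^ 2) ^ 2 * (1 - x ^ 2) by ring,
      Real.sqrt_mul (by positivity), Real.sqrt_sq (by positivity)]
  rw [solitonPrimitive, ← h]
  simp only [h2, intervalIntegral.integral_const_mul, integral_zero_one_sqrt_one_sub_sq]
  ring

section Nagy

variable {f g : ℝ → ℝ} {a : ℝ}

theorem memLp_solitonSlope (hf : MemH1On (Ici 0) f) :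
    MemLp (fun x => solitonSlope a (f x)) 2 (volume.restrict (Ici 0)) := by
  refine hf.memLp.of_le_mul (c := √(a ^ 4))
    ((continuous_solitonSlope a).comp_aestronglyMeasurable hf.aestronglyMeasurable)
    (Eventually.of_forall fun x => ?_)
  rw [solitonSlope, norm_mul, mul_comm]
  gcongr
  rw [Real.norm_of_nonneg (Real.sqrt_nonneg _)]
  exact Real.sqrt_le_sqrt (by nlinarith [sq_nonneg (f x ^ 2)])

theorem integrableOn_solitonSlope_mul_deriv (hf : MemH1On (Ici 0) f) :
    IntegrableOn (fun x => |solitonSlope a (f x) * deriv f x|) (Ici 0) :=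
  ((memLp_solitonSlope hf).integrable_mul_of_two hf.memLp_deriv).abs

/-- A composition `W ∘ f` with `f` absolutely continuous is absolutely continuous when `W` is
Lipschitz on the range of `f`, here `[-a, a]`; then the chain rule holds almost everywhere. -/
theorem solitonPrimitive_sub_eq (hf : MemH1On (Ici 0) f) (hb : ∀ x ∈ Ici (0 : ℝ), |f x| ≤ a)
    {p q : ℝ} (hp : 0 ≤ p) (hq : 0 ≤ q) :
    solitonPrimitive a (f q) - solitonPrimitive a (f p) =
      ∫ x in p..q, solitonSlope a (f x) * deriv f x := by
  have hac := hf.ac (mem_Ici.2 hp) (mem_Ici.2 hq)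
  have hsub := isEdge_Ici.uIcc_subset (mem_Ici.2 hp) (mem_Ici.2 hq)
  obtain ⟨K, hK⟩ := (isCompact_Icc (a := -a) (b := a)).exists_bound_of_continuousOn
    (continuous_solitonSlope a).continuousOn
  have hlip : ∀ x ∈ Icc (-a) a, ∀ y ∈ Icc (-a) a,
      |solitonPrimitive a x - solitonPrimitive a y| ≤ max K 0 * |x - y| := by
    intro x hx y hy
    exact (convex_Icc (-a) a).norm_image_sub_le_of_norm_hasDerivWithin_le
      (fun z hz => (hasDerivAt_solitonPrimitive a z).hasDerivWithinAt)
      (fun z hz => (hK z hz).trans (le_max_left _ _)) hy hx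
  have hWac := hac.lipschitz_comp (t := Icc (-a) a) (fun x hx => abs_le.1 (hb x (hsub hx)))
    (le_max_right K 0) hlip
  rw [← hWac.integral_deriv_eq_sub]
  refine intervalIntegral.integral_congr_ae ?_
  filter_upwards [hac.ae_differentiableAt] with x hx hxm
  exact ((hasDerivAt_solitonPrimitive a (f x)).comp x
    (hx (uIoc_subset_uIcc hxm)).hasDerivAt).deriv

theorem abs_solitonPrimitive_sub_le (hf : MemH1On (Ici 0) f) (hb : ∀ x ∈ Ici (0 : ℝ), |f x| ≤ a)
    {p q : ℝ} (hp : 0 ≤ p) (hpq : p ≤ q) :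
    |solitonPrimitive a (f q) - solitonPrimitive a (f p)| ≤
      ∫ x in Icc p q, |solitonSlope a (f x) * deriv f x| := by
  rw [solitonPrimitive_sub_eq hf hb hp (hp.trans hpq), integral_Icc_eq_integral_Ioc,
    ← intervalIntegral.integral_of_le hpq]
  exact intervalIntegral.abs_integral_le_integral_abs hpq

theorem solitonPrimitive_le (hf : MemH1On (Ici 0) f) (hb : ∀ x ∈ Ici (0 : ℝ), |f x| ≤ a)
    {p : ℝ} (hp : 0 ≤ p) :
    solitonPrimitive a (f p) ≤ ∫ x in Ici p, |solitonSlope a (f x) * deriv f x| := by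
  have hlim : Tendsto (fun q => |solitonPrimitive a (f q) - solitonPrimitive a (f p)|) atTop
      (𝓝 |solitonPrimitive a 0 - solitonPrimitive a (f p)|) :=
    (((continuous_solitonPrimitive a).tendsto 0).comp hf.tendsto_zero |>.sub_const _).abs
  rw [solitonPrimitive_zero, zero_sub, abs_neg] at hlim
  refine (le_abs_self _).trans (le_of_tendsto hlim ?_)
  filter_upwards [eventually_ge_atTop p] with q hq
  refine (abs_solitonPrimitive_sub_le hf hb hp hq).trans ?_
  exact setIntegral_mono_set
    ((integrableOn_solitonSlope_mul_deriv hf).mono_set (Ici_subset_Ici.2 hp))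
    (Eventually.of_forall fun x => abs_nonneg _) (Eventually.of_forall Icc_subset_Ici_self)

/-- The glued pair of half-lines is a line: the primitive rises from `0` at one end to its value at
`f p` and returns to `0` at the other, so its total variation is at least twice that value. -/
theorem two_mul_solitonPrimitive_le (hf : MemH1On (Ici 0) f) (hg : MemH1On (Ici 0) g)
    (h0 : f 0 = g 0) (hfb : ∀ x ∈ Ici (0 : ℝ), |f x| ≤ a) (hgb : ∀ x ∈ Ici (0 : ℝ), |g x| ≤ a)
    {p : ℝ} (hp : 0 ≤ p) :
    2 * solitonPrimitive a (f p) ≤ (∫ x in Ici 0, |solitonSlope a (f x) * deriv f x|) +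
      ∫ x in Ici 0, |solitonSlope a (g x) * deriv g x| := by
  have h1 := solitonPrimitive_le hf hfb hp
  have h2 := (le_abs_self _).trans (abs_solitonPrimitive_sub_le hf hfb le_rfl hp)
  have h3 := solitonPrimitive_le hg hgb le_rfl
  rw [← h0] at h3
  rw [setIntegral_Ici_eq_add (integrableOn_solitonSlope_mul_deriv hf) hp]
  linarith

/-- Cauchy-Schwarz, with `solitonSlope a s ^ 2 = s ^ 2 * (a ^ 4 - s ^ 4)`. The bound `|f| ≤ a` keeps
the argument of the square root nonnegative. -/
theorem sq_integral_solitonSlope_le (hf : MemH1On (Ici 0) f)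
    (hb : ∀ x ∈ Ici (0 : ℝ), |f x| ≤ a) :
    (∫ x in Ici 0, |solitonSlope a (f x) * deriv f x|) ^ 2 ≤
      (a ^ 4 * massOn (Ici 0) f - sexticOn (Ici 0) f) * kineticOn (Ici 0) f := by
  have h := sq_integral_mul_le (memLp_solitonSlope (a := a) hf).abs hf.memLp_deriv.abs
  have e1 : a ^ 4 * massOn (Ici 0) f - sexticOn (Ici 0) f
      = ∫ x in Ici 0, |solitonSlope a (f x)| ^ 2 := by
    rw [massOn, sexticOn, ← integral_const_mul, ← integral_sub (hf.integrableOn_sq.const_mul _)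
      (hf.integrableOn_sextic isEdge_Ici)]
    refine setIntegral_congr_fun measurableSet_Ici fun x hx => ?_
    have h4 : f x ^ 4 ≤ a ^ 4 := by
      have := pow_le_pow_left₀ (abs_nonneg _) (hb x hx) 4
      rwa [Even.pow_abs (by decide)] at this
    simp only [solitonSlope, sq_abs, mul_pow, Real.sq_sqrt (sub_nonneg.2 h4)]
    rw [Even.pow_abs (by decide)]
    ring
  rw [e1, kineticOn]
  simpa only [abs_mul, Pi.abs_apply] using h

theorem sq_add_le_add_mul_add {x y P Q T U : ℝ} (hP : 0 ≤ P) (hQ : 0 ≤ Q) (hT : 0 ≤ T)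
    (hU : 0 ≤ U) (h1 : x ^ 2 ≤ P * T) (h2 : y ^ 2 ≤ Q * U) :
    (x + y) ^ 2 ≤ (P + Q) * (T + U) := by
  have h3 : x * y ≤ √(P * U) * √(Q * T) := by
    rw [← Real.sqrt_mul (by positivity)]
    apply Real.le_sqrt_of_sq_le
    calc (x * y) ^ 2 = x ^ 2 * y ^ 2 := by ring
      _ ≤ (P * T) * (Q * U) := by gcongr
      _ = P * U * (Q * T) := by ring
  nlinarith [sq_nonneg (√(P * U) - √(Q * T)), Real.sq_sqrt (mul_nonneg hP hU),
    Real.sq_sqrt (mul_nonneg hQ hT)]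

theorem sexticOn_le_mul_massOn (hf : MemH1On (Ici 0) f) (hb : ∀ x ∈ Ici (0 : ℝ), |f x| ≤ a) :
    sexticOn (Ici 0) f ≤ a ^ 4 * massOn (Ici 0) f := by
  rw [massOn, sexticOn, ← integral_const_mul]
  refine setIntegral_mono_on (hf.integrableOn_sextic isEdge_Ici) (hf.integrableOn_sq.const_mul _)
    measurableSet_Ici fun x hx => ?_
  have := pow_le_pow_left₀ (abs_nonneg _) (hb x hx) 4
  nlinarith [sq_nonneg (|f x|)]

/-- Nagy's sharp inequality for two functions on half-lines that agree at the origin. -/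
theorem nagy (hf : MemH1On (Ici 0) f) (hg : MemH1On (Ici 0) g) (h0 : f 0 = g 0) :
    Real.pi ^ 2 * (sexticOn (Ici 0) f + sexticOn (Ici 0) g) ≤
      4 * (massOn (Ici 0) f + massOn (Ici 0) g) ^ 2 *
        (kineticOn (Ici 0) f + kineticOn (Ici 0) g) := by
  set A : Set ℝ := (fun x => |f x|) '' Ici 0 ∪ (fun x => |g x|) '' Ici 0
  obtain ⟨C, hC0, hC⟩ := hf.exists_bound isEdge_Ici
  obtain ⟨D, hD0, hD⟩ := hg.exists_bound isEdge_Ici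
  have hAb : BddAbove A := by
    refine ⟨max C D, ?_⟩
    rintro _ (⟨x, hx, rfl⟩ | ⟨x, hx, rfl⟩)
    · exact (hC x hx).trans (le_max_left _ _)
    · exact (hD x hx).trans (le_max_right _ _)
  have hAn : A.Nonempty := ⟨|f 0|, Or.inl ⟨0, self_mem_Ici, rfl⟩⟩
  set a := sSup A
  have hfb : ∀ x ∈ Ici (0 : ℝ), |f x| ≤ a := fun x hx => le_csSup hAb (Or.inl ⟨x, hx, rfl⟩)
  have hgb : ∀ x ∈ Ici (0 : ℝ), |g x| ≤ a := fun x hx => le_csSup hAb (Or.inr ⟨x, hx, rfl⟩)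
  have ha : 0 ≤ a := (abs_nonneg _).trans (hfb 0 self_mem_Ici)
  set J := ∫ x in Ici 0, |solitonSlope a (f x) * deriv f x| with hJ
  set J' := ∫ x in Ici 0, |solitonSlope a (g x) * deriv g x| with hJ'
  -- The inequality holds at every value of `|f|` and `|g|` and is a closed condition, so it passes
  -- to their supremum `a`; there is no need to know that `a` is attained.
  have hmem : a ∈ {y | 2 * solitonPrimitive a y ≤ J + J'} := by
    refine closure_minimal ?_ (isClosed_le (continuous_const.mul (continuous_solitonPrimitive a))
      continuous_const) (csSup_mem_closure hAn hAb)
    rintro _ (⟨x, hx, rfl⟩ | ⟨x, hx, rfl⟩)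
    · change 2 * solitonPrimitive a |f x| ≤ J + J'
      simpa only [solitonPrimitive_abs] using two_mul_solitonPrimitive_le hf hg h0 hfb hgb hx
    · change 2 * solitonPrimitive a |g x| ≤ J + J'
      have := two_mul_solitonPrimitive_le hg hf h0.symm hgb hfb hx
      rw [add_comm] at this
      simpa only [solitonPrimitive_abs] using this
  simp only [mem_ofPred_eq, solitonPrimitive_self] at hmem
  have h1 := sq_integral_solitonSlope_le hf hfb
  have h2 := sq_integral_solitonSlope_le hg hgb
  have hP := sub_nonneg.2 (sexticOn_le_mul_massOn hf hfb)
  have hQ := sub_nonneg.2 (sexticOn_le_mul_massOn hg hgb)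
  have hT := kineticOn_nonneg (Ici 0) f
  have hU := kineticOn_nonneg (Ici 0) g
  have h3 := sq_add_le_add_mul_add hP hQ hT hU h1 h2
  have h4 : (a ^ 4 * Real.pi / 4) ^ 2 ≤ (J + J') ^ 2 := by
    apply pow_le_pow_left₀ (by positivity)
    linarith
  have h5 := h4.trans h3
  set S := sexticOn (Ici 0) f + sexticOn (Ici 0) g with hS
  set M := massOn (Ici 0) f + massOn (Ici 0) g with hM
  set T := kineticOn (Ici 0) f + kineticOn (Ici 0) g with hTT
  have h6 : (a ^ 4 * Real.pi / 4) ^ 2 ≤ (a ^ 4 * M - S) * T := by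
    refine h5.trans (le_of_eq ?_)
    rw [hS, hM]; ring
  -- If `T = 0` the estimate forces `a = 0`, hence `S = 0`; otherwise it can be divided by `T`.
  have hT0 : 0 ≤ T := add_nonneg hT hU
  rcases hT0.eq_or_lt with hT0 | hT0
  · rw [← hT0, mul_zero] at h6
    have h7 : a ^ 4 * Real.pi / 4 = 0 := pow_eq_zero_iff two_ne_zero |>.1
      (le_antisymm h6 (sq_nonneg _))
    have h8 : a ^ 4 = 0 := by
      have := Real.pi_pos
      have h9 : a ^ 4 * Real.pi = 0 := by linarith
      exact (mul_eq_zero.1 h9).resolve_right this.ne'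
    rw [← hT0, mul_zero]
    rw [h8] at hP hQ
    have : S ≤ 0 := by rw [hS]; linarith
    nlinarith [sq_nonneg Real.pi]
  -- The unknown height is eliminated by maximizing over `a ^ 4`: the slack is the square `(2 * M *
  -- T - π ^ 2 * a ^ 4 / 4) ^ 2`.
  · have h7 : Real.pi ^ 2 * S * T ≤ 4 * M ^ 2 * T * T := by
      have h8 := mul_le_mul_of_nonneg_left h6 (sq_nonneg Real.pi)
      nlinarith [sq_nonneg (2 * M * T - Real.pi ^ 2 * a ^ 4 / 4)]
    exact le_of_mul_le_mul_right h7 hT0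

end Nagy

/-! ### The critical mass -/

namespace MetricGraph

variable {V B L : Type*} [Fintype B] [Fintype L]

theorem mass_eq (G : MetricGraph V B L) (u : B ⊕ L → ℝ → ℝ) :
    G.mass u = ∑ e, massOn (G.edge e) (u e) := rfl

theorem kinetic_eq (G : MetricGraph V B L) (u : B ⊕ L → ℝ → ℝ) :
    G.kinetic u = ∑ e, kineticOn (G.edge e) (u e) := rfl

theorem sextic_eq (G : MetricGraph V B L) (u : B ⊕ L → ℝ → ℝ) :
    G.sextic u = ∑ e, sexticOn (G.edge e) (u e) := rfl

/-- The Gagliardo-Nirenberg inequality holds with the critical mass itself. -/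
theorem gagliardoNirenberg (G : MetricGraph V B L) (h : 0 < G.criticalMass) {u : B ⊕ L → ℝ → ℝ}
    (hu : u ∈ G.H1) : G.criticalMass ^ 2 * G.sextic u ≤ 3 * G.mass u ^ 2 * G.kinetic u := by
  set X := {m : ℝ | 0 ≤ m ∧ ∀ u ∈ G.H1, m ^ 2 * G.sextic u ≤ 3 * G.mass u ^ 2 * G.kinetic u}
  have hX : G.criticalMass = sSup X := rfl
  -- `sSup` is `0` on empty and on unbounded sets, so positivity of the critical mass rules out
  -- both; the inequality, closed in `m`, then holds at the supremum.
  have hne : X.Nonempty := by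
    by_contra hc
    rw [not_nonempty_iff_eq_empty] at hc
    rw [hX, hc, Real.sSup_empty] at h
    exact lt_irrefl _ h
  have hb : BddAbove X := by
    by_contra hc
    rw [hX, Real.sSup_of_not_bddAbove hc] at h
    exact lt_irrefl _ h
  have hcl : IsClosed {m : ℝ | m ^ 2 * G.sextic u ≤ 3 * G.mass u ^ 2 * G.kinetic u} :=
    isClosed_le (by fun_prop) (by fun_prop)
  exact closure_minimal (fun m hm => hm.2 u hu) hcl (csSup_mem_closure hne hb)

/-- A single test function with positive sextic term bounds the admissible constants from above;
otherwise `sSup` could take its default value `0`. -/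
theorem le_criticalMass (G : MetricGraph V B L) {m : ℝ} (hm : 0 ≤ m)
    (h : ∀ u ∈ G.H1, m ^ 2 * G.sextic u ≤ 3 * G.mass u ^ 2 * G.kinetic u)
    {w : B ⊕ L → ℝ → ℝ} (hw : w ∈ G.H1) (hpos : 0 < G.sextic w) : m ≤ G.criticalMass := by
  refine le_csSup ⟨√(3 * G.mass w ^ 2 * G.kinetic w / G.sextic w), ?_⟩ ⟨hm, h⟩
  rintro k ⟨hk0, hk⟩
  apply Real.le_sqrt_of_sq_le
  rw [le_div_iff₀ hpos]
  exact hk w hw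

end MetricGraph

open MetricGraph in
theorem realLine_mass (u : Empty ⊕ Bool → ℝ → ℝ) : realLine.mass u =
    massOn (Ici 0) (u (Sum.inr true)) + massOn (Ici 0) (u (Sum.inr false)) := by
  rw [mass_eq, Fintype.sum_sum_type]; simp [MetricGraph.edge]

open MetricGraph in
theorem realLine_kinetic (u : Empty ⊕ Bool → ℝ → ℝ) : realLine.kinetic u =
    kineticOn (Ici 0) (u (Sum.inr true)) + kineticOn (Ici 0) (u (Sum.inr false)) := by
  rw [kinetic_eq, Fintype.sum_sum_type]; simp [MetricGraph.edge]

open MetricGraph in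
theorem realLine_sextic (u : Empty ⊕ Bool → ℝ → ℝ) : realLine.sextic u =
    sexticOn (Ici 0) (u (Sum.inr true)) + sexticOn (Ici 0) (u (Sum.inr false)) := by
  rw [sextic_eq, Fintype.sum_sum_type]; simp [MetricGraph.edge]

theorem memH1On_exp_neg : MemH1On (Ici 0) fun x => Real.exp (-x) := by
  have h1 : MemLp (fun x : ℝ => Real.exp (-x)) 2 (volume.restrict (Ici 0)) := by
    rw [memLp_two_iff_integrable_sq (by fun_prop)]
    have := integrableOn_exp_mul_Ioi (a := -2) (by norm_num) 0
    have h2 : (fun x : ℝ => Real.exp (-x) ^ 2) = fun x => Real.exp (-2 * x) := by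
      funext x; rw [← Real.exp_nat_mul]; congr 1; push_cast; ring
    rw [h2]
    exact (integrableOn_Ici_iff_integrableOn_Ioi).2 this
  have h2 : deriv (fun x : ℝ => Real.exp (-x)) = fun x => -Real.exp (-x) := by
    funext x
    simpa using ((hasDerivAt_id x).neg.exp).deriv
  exact MemH1On.of_contDiff (by fun_prop) h1 (by rw [h2]; exact h1.neg)

theorem sexticOn_exp_neg_pos : 0 < sexticOn (Ici 0) fun x => Real.exp (-x) := by
  rw [sexticOn, setIntegral_pos_iff_support_of_nonneg_ae
    (Eventually.of_forall fun x => by positivity) (memH1On_exp_neg.integrableOn_sextic isEdge_Ici)]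
  have : (Function.support fun x => |Real.exp (-x)| ^ 6) = univ := by
    ext x; simp [Real.exp_ne_zero]
  rw [this, univ_inter]
  simp

/-- The critical mass of the line is at least the mass of the soliton. -/
theorem soliton_mass_le_realLine_criticalMass :
    √3 * Real.pi / 2 ≤ MetricGraph.realLine.criticalMass := by
  refine MetricGraph.le_criticalMass _ (by positivity) (fun u hu => ?_)
    (w := fun _ x => Real.exp (-x)) ?_ ?_
  · obtain ⟨hu1, h, -, h2⟩ := hu
    have := nagy (hu1 (Sum.inr true)) (hu1 (Sum.inr false)) ((h2 true).trans (h2 false).symm)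
    rw [realLine_sextic, realLine_mass, realLine_kinetic, div_pow, mul_pow,
      Real.sq_sqrt (by norm_num)]
    linarith
  · refine ⟨fun e => ?_, fun _ => 1, fun b => b.elim, fun l => by simp⟩
    rcases e with e | e
    · exact e.elim
    · exact memH1On_exp_neg
  · rw [realLine_sextic]
    exact add_pos sexticOn_exp_neg_pos sexticOn_exp_neg_pos

theorem realLine_criticalMass_pos : 0 < MetricGraph.realLine.criticalMass :=
  lt_of_lt_of_le (by positivity) soliton_mass_le_realLine_criticalMass

/-- The Gagliardo-Nirenberg inequality on the half-line, by even reflection. -/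
theorem gagliardoNirenberg_Ici {f : ℝ → ℝ} (hf : MemH1On (Ici 0) f) :
    MetricGraph.realLine.criticalMass ^ 2 * sexticOn (Ici 0) f ≤
      12 * massOn (Ici 0) f ^ 2 * kineticOn (Ici 0) f := by
  have hu : (fun _ => f : Empty ⊕ Bool → ℝ → ℝ) ∈ MetricGraph.realLine.H1 := by
    refine ⟨fun e => ?_, fun _ => f 0, fun b => b.elim, fun l => rfl⟩
    rcases e with e | e
    · exact e.elim
    · exact hf
  have := MetricGraph.realLine.gagliardoNirenberg realLine_criticalMass_pos hu
  rw [realLine_sextic, realLine_mass, realLine_kinetic] at this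
  nlinarith

theorem gagliardoNirenberg_tail {f : ℝ → ℝ} (hf : MemH1On (Ici 0) f) {R : ℝ} (hR : 0 ≤ R) :
    MetricGraph.realLine.criticalMass ^ 2 * sexticOn (Ici R) f ≤
      12 * massOn (Ici R) f ^ 2 * kineticOn (Ici R) f := by
  have := gagliardoNirenberg_Ici (hf.comp_add_right hR)
  rwa [massOn_comp_add, sexticOn_comp_add, kineticOn_comp_add] at this

/-- The critical mass of the line. -/
noncomputable abbrev lineMass : ℝ := MetricGraph.realLine.criticalMass

theorem lineMass_pos : 0 < lineMass := realLine_criticalMass_pos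

/-- On a tail of a half-line that carries at most a third of the critical mass of the line, the
sextic term is controlled by the kinetic term. -/
theorem sexticOn_tail_le {f : ℝ → ℝ} (hf : MemH1On (Ici 0) f) {R : ℝ} (hR : 0 ≤ R)
    (hm : massOn (Ici R) f ≤ lineMass / 3) :
    sexticOn (Ici R) f ≤ 4 / 3 * kineticOn (Ici R) f := by
  have h1 := gagliardoNirenberg_tail hf hR
  have h2 : massOn (Ici R) f ^ 2 ≤ (lineMass / 3) ^ 2 :=
    pow_le_pow_left₀ (massOn_nonneg _ _) hm 2
  have h3 := mul_le_mul_of_nonneg_right h2 (kineticOn_nonneg (Ici R) f)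
  have h4 : lineMass ^ 2 * sexticOn (Ici R) f ≤ lineMass ^ 2 * (4 / 3 * kineticOn (Ici R) f) := by
    change MetricGraph.realLine.criticalMass ^ 2 * _ ≤ _
    linarith
  exact le_of_mul_le_mul_left h4 (pow_pos lineMass_pos 2)

/-! ### Removing a half-line: coercivity when it carries exactly `lineMass / 3` -/

namespace MetricGraph

variable {V B L : Type*}

section Restrict

/-- The restriction of a function on `G` to the graph without the half-line `l`. -/
def restrictRemove (l : L) (u : B ⊕ L → ℝ → ℝ) : B ⊕ {k : L // k ≠ l} → ℝ → ℝ :=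
  fun e => u (Sum.map id Subtype.val e)

theorem restrictRemove_mem_H1 (G : MetricGraph V B L) (l : L) {u : B ⊕ L → ℝ → ℝ}
    (hu : u ∈ G.H1) : restrictRemove l u ∈ (G.removeHalfLine l).H1 := by
  obtain ⟨h1, h, h2, h3⟩ := hu
  refine ⟨fun e => ?_, h, h2, fun k => h3 k.1⟩
  rcases e with b | k
  · exact h1 (Sum.inl b)
  · exact h1 (Sum.inr k.1)

variable [Fintype B] [Fintype L] [DecidableEq L]

theorem sum_removeHalfLine (l : L) (F : B ⊕ L → ℝ) :
    ∑ e, F e = (∑ e : B ⊕ {k : L // k ≠ l}, F (Sum.map id Subtype.val e)) + F (Sum.inr l) := by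
  rw [Fintype.sum_sum_type, Fintype.sum_sum_type,
    Fintype.sum_eq_add_sum_subtype_ne (fun k => F (Sum.inr k)) l]
  simp only [Sum.map_inl, Sum.map_inr, id]
  ring

theorem mass_removeHalfLine (G : MetricGraph V B L) (l : L) (u : B ⊕ L → ℝ → ℝ) :
    G.mass u = (G.removeHalfLine l).mass (restrictRemove l u) +
      massOn (Ici 0) (u (Sum.inr l)) := by
  rw [mass_eq, mass_eq, sum_removeHalfLine l]
  congr 1
  refine Finset.sum_congr rfl fun e _ => ?_
  rcases e with b | k <;> rfl

theorem kinetic_removeHalfLine (G : MetricGraph V B L) (l : L) (u : B ⊕ L → ℝ → ℝ) :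
    G.kinetic u = (G.removeHalfLine l).kinetic (restrictRemove l u) +
      kineticOn (Ici 0) (u (Sum.inr l)) := by
  rw [kinetic_eq, kinetic_eq, sum_removeHalfLine l]
  congr 1
  refine Finset.sum_congr rfl fun e _ => ?_
  rcases e with b | k <;> rfl

theorem sextic_removeHalfLine (G : MetricGraph V B L) (l : L) (u : B ⊕ L → ℝ → ℝ) :
    G.sextic u = (G.removeHalfLine l).sextic (restrictRemove l u) +
      sexticOn (Ici 0) (u (Sum.inr l)) := by
  rw [sextic_eq, sextic_eq, sum_removeHalfLine l]
  congr 1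
  refine Finset.sum_congr rfl fun e _ => ?_
  rcases e with b | k <;> rfl

/-- If a half-line carries exactly a third of the critical mass of the line and removing it does
not change the critical mass, then the energy is coercive. -/
theorem sextic_le_of_mass_eq_third (G : MetricGraph V B L) {l : L}
    (hl : (G.removeHalfLine l).criticalMass = lineMass) {u : B ⊕ L → ℝ → ℝ} (hu : u ∈ G.H1)
    (hmass : G.mass u ≤ lineMass) (hm : massOn (Ici 0) (u (Sum.inr l)) = lineMass / 3) :
    G.sextic u ≤ 4 / 3 * G.kinetic u := by
  have h1 := (G.removeHalfLine l).gagliardoNirenberg (by rw [hl]; exact lineMass_pos)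
    (restrictRemove_mem_H1 G l hu)
  have h2 := sexticOn_tail_le (hu.1 (Sum.inr l)) le_rfl hm.le
  rw [hl] at h1
  rw [mass_removeHalfLine G l u, hm] at hmass
  rw [sextic_removeHalfLine G l u, kinetic_removeHalfLine G l u]
  have h0 : 0 ≤ (G.removeHalfLine l).mass (restrictRemove l u) :=
    Finset.sum_nonneg fun _ _ => massOn_nonneg _ _
  have hk : 0 ≤ (G.removeHalfLine l).kinetic (restrictRemove l u) :=
    Finset.sum_nonneg fun _ _ => kineticOn_nonneg _ _
  -- The remaining mass is at most `2 / 3 * lineMass`, and `3 * (2 / 3) ^ 2 = 4 / 3` is the constant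
  -- already obtained on the half-line.
  have h3 : (G.removeHalfLine l).mass (restrictRemove l u) ^ 2 ≤ (2 / 3 * lineMass) ^ 2 :=
    pow_le_pow_left₀ h0 (by linarith) 2
  have h4 := mul_le_mul_of_nonneg_right h3 hk
  have h5 : (G.removeHalfLine l).sextic (restrictRemove l u) ≤
      4 / 3 * (G.removeHalfLine l).kinetic (restrictRemove l u) := by
    refine le_of_mul_le_mul_left (a := lineMass ^ 2) ?_ (pow_pos lineMass_pos 2)
    linarith
  linarith

end Restrict

/-! ### Coercivity when the kinetic term is small -/

variable [Fintype B] [Fintype L]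

theorem mass_nonneg (G : MetricGraph V B L) (u : B ⊕ L → ℝ → ℝ) : 0 ≤ G.mass u :=
  Finset.sum_nonneg fun _ _ => massOn_nonneg _ _

theorem kinetic_nonneg (G : MetricGraph V B L) (u : B ⊕ L → ℝ → ℝ) : 0 ≤ G.kinetic u :=
  Finset.sum_nonneg fun _ _ => kineticOn_nonneg _ _

theorem sextic_nonneg (G : MetricGraph V B L) (u : B ⊕ L → ℝ → ℝ) : 0 ≤ G.sextic u :=
  Finset.sum_nonneg fun _ _ => sexticOn_nonneg _ _

theorem massOn_le_mass (G : MetricGraph V B L) (u : B ⊕ L → ℝ → ℝ) (e : B ⊕ L) :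
    massOn (G.edge e) (u e) ≤ G.mass u :=
  Finset.single_le_sum (f := fun e => massOn (G.edge e) (u e))
    (fun _ _ => massOn_nonneg _ _) (Finset.mem_univ e)

theorem kineticOn_le_kinetic (G : MetricGraph V B L) (u : B ⊕ L → ℝ → ℝ) (e : B ⊕ L) :
    kineticOn (G.edge e) (u e) ≤ G.kinetic u :=
  Finset.single_le_sum (f := fun e => kineticOn (G.edge e) (u e))
    (fun _ _ => kineticOn_nonneg _ _) (Finset.mem_univ e)

/-- On a bounded edge a function differs from its value at the origin of the edge by at most
a multiple of the square root of its kinetic term. -/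
theorem abs_sub_zero_le (G : MetricGraph V B L) {u : B ⊕ L → ℝ → ℝ} (hu : u ∈ G.H1) (b : B)
    {x : ℝ} (hx : x ∈ Icc 0 (G.len b)) :
    |u (Sum.inl b) x - u (Sum.inl b) 0| ≤ √(G.len b) * √(G.kinetic u) := by
  have he := isEdge_Icc (G.len_pos b)
  have h1 := (hu.1 (Sum.inl b)).abs_sub_le he he.zero_mem hx
  rw [← Real.sqrt_mul (G.len_pos b).le]
  refine h1.trans (Real.sqrt_le_sqrt ?_)
  refine mul_le_mul ?_ (G.kineticOn_le_kinetic u (Sum.inl b)) (kineticOn_nonneg _ _)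
    (G.len_pos b).le
  rw [sub_zero, abs_of_nonneg hx.1]
  exact hx.2

/-- On a connected graph, the values at two vertices differ by at most a multiple of the square
root of the kinetic term. -/
theorem exists_abs_vertex_sub_le [Finite V] (G : MetricGraph V B L) (hconn : G.Connected) (v : V) :
    ∃ C, 0 ≤ C ∧ ∀ u ∈ G.H1, ∀ h : V → ℝ,
      (∀ b, u (Sum.inl b) 0 = h (G.src b) ∧ u (Sum.inl b) (G.len b) = h (G.tgt b)) →
      ∀ w, |h w - h v| ≤ C * √(G.kinetic u) := by
  have key : ∀ w, ∃ C, 0 ≤ C ∧ ∀ u ∈ G.H1, ∀ h : V → ℝ,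
      (∀ b, u (Sum.inl b) 0 = h (G.src b) ∧ u (Sum.inl b) (G.len b) = h (G.tgt b)) →
      |h w - h v| ≤ C * √(G.kinetic u) := by
    -- Adding the estimates of `abs_sub_zero_le` along a path of bounded edges from `w` to `v`.
    intro w
    obtain ⟨p⟩ := hconn.preconnected w v
    induction p with
    | nil => exact ⟨0, le_rfl, fun u _ h _ => by simp⟩
    | @cons x y z hadj p ih =>
      obtain ⟨C, hC, H⟩ := ih
      rw [SimpleGraph.fromRel_adj] at hadj
      have hedge : ∃ b : B, ∀ u ∈ G.H1, ∀ h : V → ℝ,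
          (∀ b, u (Sum.inl b) 0 = h (G.src b) ∧ u (Sum.inl b) (G.len b) = h (G.tgt b)) →
          |h x - h y| ≤ √(G.len b) * √(G.kinetic u) := by
        rcases hadj.2 with ⟨b, hs, ht⟩ | ⟨b, hs, ht⟩
        · refine ⟨b, fun u hu h hh => ?_⟩
          have := G.abs_sub_zero_le hu b (right_mem_Icc.2 (G.len_pos b).le)
          rwa [(hh b).1, (hh b).2, hs, ht, abs_sub_comm] at this
        · refine ⟨b, fun u hu h hh => ?_⟩
          have := G.abs_sub_zero_le hu b (right_mem_Icc.2 (G.len_pos b).le)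
          rwa [(hh b).1, (hh b).2, hs, ht] at this
      obtain ⟨b, hb⟩ := hedge
      refine ⟨√(G.len b) + C, by positivity, fun u hu h hh => ?_⟩
      calc |h x - h z| = |(h x - h y) + (h y - h z)| := by ring_nf
        _ ≤ |h x - h y| + |h y - h z| := abs_add_le _ _
        _ ≤ _ := by rw [add_mul]; exact add_le_add (hb u hu h hh) (H u hu h hh)
  choose C hC H using key
  have := Fintype.ofFinite V
  refine ⟨∑ w, C w, Finset.sum_nonneg fun w _ => hC w, fun u hu h hh w => ?_⟩
  refine (H w u hu h hh).trans (mul_le_mul_of_nonneg_right ?_ (Real.sqrt_nonneg _))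
  exact Finset.single_le_sum (fun w _ => hC w) (Finset.mem_univ w)

/-- The value of an `H¹` function at the origin of a half-line, in terms of its mass and of the
square root `r` of (a bound for) its kinetic term. -/
theorem abs_zero_le_of_kineticOn_le {f : ℝ → ℝ} (hf : MemH1On (Ici 0) f) {r M : ℝ} (hr : 0 < r)
    (hT : kineticOn (Ici 0) f ≤ r ^ 2) (hM : massOn (Ici 0) f ≤ M) :
    |f 0| ≤ (√M + 1) * √r := by
  -- An interval of length `1 / r` balances the two terms: each becomes of order `√r`.
  have h := hf.abs_le isEdge_Ici (inv_pos.2 hr) (hasWidth_Ici _ (inv_pos.2 hr).le)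
    (x := 0) self_mem_Ici
  have h1 : √(massOn (Ici 0) f / r⁻¹) ≤ √M * √r := by
    rw [div_inv_eq_mul, Real.sqrt_mul (massOn_nonneg _ _)]
    gcongr
  have h2 : √(r⁻¹ * kineticOn (Ici 0) f) ≤ √r := by
    apply Real.sqrt_le_sqrt
    rw [inv_mul_le_iff₀ hr]
    linarith [sq r]
  linarith

/-- Small kinetic term: the sextic term on the compact core is small compared with the kinetic
term. -/
theorem exists_kinetic_threshold [Finite V] (G : MetricGraph V B L) (hconn : G.Connected)
    (hL : Nonempty L) {M : ℝ} {ε : ℝ} (hε : 0 < ε) :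
    ∃ K, 0 < K ∧ ∀ u ∈ G.H1, G.mass u ≤ M → 0 < G.kinetic u → G.kinetic u ≤ K →
      ∑ b, sexticOn (Icc 0 (G.len b)) (u (Sum.inl b)) ≤ ε * G.kinetic u := by
  obtain ⟨l⟩ := hL
  obtain ⟨C, hC, H⟩ := G.exists_abs_vertex_sub_le hconn (G.root l)
  set D : ℝ := ∑ b, √(G.len b)
  set Λ : ℝ := ∑ b, G.len b
  have hD : 0 ≤ D := Finset.sum_nonneg fun b _ => Real.sqrt_nonneg _
  have hΛ : 0 ≤ Λ := Finset.sum_nonneg fun b _ => (G.len_pos b).le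
  set N : ℝ := √M + 1 + C + D with hN
  have hN0 : 0 ≤ N := by positivity
  -- With `r = √T`, functions on the core are bounded by `N * √r`, so the sextic term there is at
  -- most `Λ * N ^ 6 * r ^ 3`. This is at most `ε * r ^ 2` once `r ≤ ε / (Λ * N ^ 6 + 1)`; `r ≤ 1`
  -- allows `r` to be absorbed into `√r`.
  set κ : ℝ := min 1 (ε / (Λ * N ^ 6 + 1)) with hκ
  have hκ0 : 0 < κ := lt_min one_pos (by positivity)
  refine ⟨κ ^ 2, by positivity, fun u hu hM hT0 hT => ?_⟩
  set r := √(G.kinetic u) with hr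
  have hr0 : 0 < r := Real.sqrt_pos.2 hT0
  have hr2 : r ^ 2 = G.kinetic u := Real.sq_sqrt hT0.le
  have hrκ : r ≤ κ := by rw [hr]; exact Real.sqrt_le_iff.2 ⟨hκ0.le, hT⟩
  have hr1 : r ≤ 1 := hrκ.trans (min_le_left _ _)
  have hrq : r ≤ √r := by
    apply Real.le_sqrt_of_sq_le
    nlinarith
  obtain ⟨h, hb, hl⟩ := hu.2
  have hroot : |h (G.root l)| ≤ (√M + 1) * √r := by
    rw [← hl l]
    refine abs_zero_le_of_kineticOn_le (hu.1 (Sum.inr l)) hr0 ?_ ?_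
    · rw [hr2]; exact G.kineticOn_le_kinetic u (Sum.inr l)
    · exact (G.massOn_le_mass u (Sum.inr l)).trans hM
  have hpt : ∀ b, ∀ x ∈ Icc 0 (G.len b), |u (Sum.inl b) x| ≤ N * √r := by
    intro b x hx
    have h1 := G.abs_sub_zero_le hu b hx
    have h2 := H u hu h hb (G.src b)
    rw [(hb b).1] at h1
    have h3 : √(G.len b) ≤ D := Finset.single_le_sum (f := fun b => √(G.len b))
      (fun b _ => Real.sqrt_nonneg _) (Finset.mem_univ b)
    have h4 : √(G.len b) * r ≤ D * √r := by gcongr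
    have h5 : C * r ≤ C * √r := by gcongr
    calc |u (Sum.inl b) x| = |(u (Sum.inl b) x - h (G.src b)) + (h (G.src b) - h (G.root l))
          + h (G.root l)| := by ring_nf
      _ ≤ |u (Sum.inl b) x - h (G.src b)| + |h (G.src b) - h (G.root l)| + |h (G.root l)| :=
        abs_add_three _ _ _
      _ ≤ N * √r := by rw [hN]; linarith
  have hS : ∀ b, sexticOn (Icc 0 (G.len b)) (u (Sum.inl b)) ≤ G.len b * (N * √r) ^ 6 := by
    intro b
    have h1 : sexticOn (Icc 0 (G.len b)) (u (Sum.inl b)) ≤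
        ∫ x in Icc 0 (G.len b), (N * √r) ^ 6 := by
      refine setIntegral_mono_on ((hu.1 (Sum.inl b)).integrableOn_sextic
        (isEdge_Icc (G.len_pos b))) (integrableOn_const (by simp)) measurableSet_Icc
        fun x hx => pow_le_pow_left₀ (abs_nonneg _) (hpt b x hx) 6
    refine h1.trans (le_of_eq ?_)
    simp [(G.len_pos b).le]
  calc ∑ b, sexticOn (Icc 0 (G.len b)) (u (Sum.inl b)) ≤ ∑ b, G.len b * (N * √r) ^ 6 :=
        Finset.sum_le_sum fun b _ => hS b
    _ = Λ * N ^ 6 * r * r ^ 2 := by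
        rw [← Finset.sum_mul, mul_pow, show √r ^ 6 = (√r ^ 2) ^ 3 by ring, Real.sq_sqrt hr0.le]
        ring
    _ ≤ ε * r ^ 2 := by
        gcongr
        have h1 : r ≤ ε / (Λ * N ^ 6 + 1) := hrκ.trans (min_le_right _ _)
        rw [le_div_iff₀ (by positivity)] at h1
        nlinarith
    _ = ε * G.kinetic u := by rw [hr2]

/-- If the kinetic term is small and no half-line carries more than a third of the critical mass
of the line, then the energy is coercive. -/
theorem exists_kinetic_barrier [Finite V] (G : MetricGraph V B L) (hconn : G.Connected)
    (hL : Nonempty L) (hG : G.criticalMass = lineMass) :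
    ∃ K, 0 < K ∧ ∀ u ∈ G.H1, G.mass u ≤ lineMass →
      (∀ l, massOn (Ici 0) (u (Sum.inr l)) ≤ lineMass / 3) → G.kinetic u ≤ K →
      G.sextic u ≤ 3 / 2 * G.kinetic u := by
  -- The choice `ε = 1 / 6` gives `4 / 3 + 1 / 6 = 3 / 2`, and thus `E ≥ T / 4`.
  obtain ⟨K, hK, H⟩ := G.exists_kinetic_threshold hconn hL (M := lineMass) (ε := 1 / 6)
    (by norm_num)
  refine ⟨K, hK, fun u hu hM hl hT => ?_⟩
  rcases (G.kinetic_nonneg u).eq_or_lt with h0 | h0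
  · have := G.gagliardoNirenberg (by rw [hG]; exact lineMass_pos) hu
    rw [← h0, mul_zero, hG] at this
    rw [← h0, mul_zero]
    exact nonpos_of_mul_nonpos_right this (pow_pos lineMass_pos 2)
  · have h1 := H u hu hM h0 hT
    have h2 : ∑ l, sexticOn (Ici 0) (u (Sum.inr l)) ≤
        4 / 3 * ∑ l, kineticOn (Ici 0) (u (Sum.inr l)) := by
      rw [Finset.mul_sum]
      exact Finset.sum_le_sum fun l _ => sexticOn_tail_le (hu.1 (Sum.inr l)) le_rfl (hl l)
    have h3 : ∑ l, kineticOn (Ici 0) (u (Sum.inr l)) ≤ G.kinetic u := by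
      rw [kinetic_eq, Fintype.sum_sum_type]
      exact le_add_of_nonneg_left (Finset.sum_nonneg fun _ _ => kineticOn_nonneg _ _)
    rw [sextic_eq, Fintype.sum_sum_type]
    change ∑ b, sexticOn (Icc 0 (G.len b)) (u (Sum.inl b)) +
      ∑ l, sexticOn (Ici 0) (u (Sum.inr l)) ≤ _
    linarith

end MetricGraph

/-! ### Concentrated functions of almost critical mass -/

theorem setIntegral_Icc_comp_mul_sub (F : ℝ → ℝ) {d lam r : ℝ} (hd : 0 < d) (hlam : 0 < lam)
    (hr : lam * d = 2 * r) :
    ∫ x in Icc 0 d, F (lam * x - r) = lam⁻¹ * ∫ y in (-r)..r, F y := by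
  rw [integral_Icc_eq_integral_Ioc, ← intervalIntegral.integral_of_le hd.le,
    intervalIntegral.integral_comp_mul_sub _ hlam.ne', hr, smul_eq_mul]
  congr 2 <;> ring

section Scaling

variable {p : ℝ → ℝ} {d lam r a : ℝ}

theorem massOn_scaling (p : ℝ → ℝ) (a : ℝ) (hd : 0 < d) (hlam : 0 < lam) (hr : lam * d = 2 * r) :
    massOn (Icc 0 d) (fun x => a * p (lam * x - r)) =
      a ^ 2 * lam⁻¹ * ∫ y in (-r)..r, p y ^ 2 := by
  have := setIntegral_Icc_comp_mul_sub (fun y => a ^ 2 * p y ^ 2) hd hlam hr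
  simp only [massOn, sq_abs, mul_pow]
  rw [this, intervalIntegral.integral_const_mul]
  ring

theorem sexticOn_scaling (p : ℝ → ℝ) (a : ℝ) (hd : 0 < d) (hlam : 0 < lam)
    (hr : lam * d = 2 * r) :
    sexticOn (Icc 0 d) (fun x => a * p (lam * x - r)) =
      a ^ 6 * lam⁻¹ * ∫ y in (-r)..r, p y ^ 6 := by
  have := setIntegral_Icc_comp_mul_sub (fun y => a ^ 6 * p y ^ 6) hd hlam hr
  simp only [sexticOn, Even.pow_abs (show Even 6 by decide), mul_pow]
  rw [this, intervalIntegral.integral_const_mul]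
  ring

theorem kineticOn_scaling {p' : ℝ → ℝ} (hp : ∀ y, HasDerivAt p (p' y) y) (a : ℝ) (hd : 0 < d)
    (hlam : 0 < lam) (hr : lam * d = 2 * r) :
    kineticOn (Icc 0 d) (fun x => a * p (lam * x - r)) =
      a ^ 2 * lam * ∫ y in (-r)..r, p' y ^ 2 := by
  have hder : deriv (fun x => a * p (lam * x - r)) = fun x => a * (p' (lam * x - r) * lam) := by
    funext x
    have h1 : HasDerivAt (fun x : ℝ => lam * x - r) lam x := by
      simpa using ((hasDerivAt_id x).const_mul lam).sub_const r
    exact ((HasDerivAt.comp (h₂ := p) x (hp _) h1).const_mul a).deriv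
  have := setIntegral_Icc_comp_mul_sub (fun y => a ^ 2 * lam ^ 2 * p' y ^ 2) hd hlam hr
  simp only [kineticOn, hder, sq_abs, mul_pow]
  have hcancel : lam⁻¹ * (a ^ 2 * lam ^ 2 * ∫ y in (-r)..r, p' y ^ 2) =
      a ^ 2 * lam * ∫ y in (-r)..r, p' y ^ 2 := by field_simp
  have e : ∀ x, a ^ 2 * (p' (lam * x - r) ^ 2 * lam ^ 2)
      = a ^ 2 * lam ^ 2 * p' (lam * x - r) ^ 2 := fun x => by ring
  simp only [e]
  rw [this, intervalIntegral.integral_const_mul, hcancel]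

end Scaling

/-- The soliton profile `sech(2y)^{1/2}`. -/
noncomputable def soliton (y : ℝ) : ℝ := (√(Real.cosh (2 * y)))⁻¹

/-- The derivative of the soliton profile. -/
noncomputable def solitonDeriv (y : ℝ) : ℝ :=
  -(Real.sinh (2 * y) / (Real.cosh (2 * y) * √(Real.cosh (2 * y))))

theorem soliton_pos (y : ℝ) : 0 < soliton y := inv_pos.2 (Real.sqrt_pos.2 (Real.cosh_pos _))

theorem soliton_le_one (y : ℝ) : soliton y ≤ 1 :=
  inv_le_one_of_one_le₀ (Real.one_le_sqrt.2 (Real.one_le_cosh _))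

theorem soliton_neg (y : ℝ) : soliton (-y) = soliton y := by simp [soliton]

theorem soliton_le_of_abs_le {x y : ℝ} (h : |x| ≤ |y|) : soliton y ≤ soliton x := by
  have : Real.cosh (2 * x) ≤ Real.cosh (2 * y) := by
    rw [Real.cosh_le_cosh, abs_mul, abs_mul]; gcongr
  unfold soliton
  gcongr

theorem soliton_sq (y : ℝ) : soliton y ^ 2 = (Real.cosh (2 * y))⁻¹ := by
  rw [soliton, inv_pow, Real.sq_sqrt (Real.cosh_pos _).le]

theorem hasDerivAt_two_mul (y : ℝ) : HasDerivAt (fun y : ℝ => 2 * y) 2 y := by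
  simpa using (hasDerivAt_id y).const_mul 2

theorem hasDerivAt_cosh_two_mul (y : ℝ) :
    HasDerivAt (fun y : ℝ => Real.cosh (2 * y)) (2 * Real.sinh (2 * y)) y := by
  have := (hasDerivAt_two_mul y).cosh
  rwa [mul_comm] at this

theorem hasDerivAt_sinh_two_mul (y : ℝ) :
    HasDerivAt (fun y : ℝ => Real.sinh (2 * y)) (2 * Real.cosh (2 * y)) y := by
  have := (hasDerivAt_two_mul y).sinh
  rwa [mul_comm] at this

theorem hasDerivAt_soliton (y : ℝ) : HasDerivAt soliton (solitonDeriv y) y := by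
  have hc := Real.cosh_pos (2 * y)
  have h := ((hasDerivAt_cosh_two_mul y).sqrt hc.ne').inv (Real.sqrt_pos.2 hc).ne'
  convert! h using 1
  rw [solitonDeriv, Real.sq_sqrt hc.le]
  field_simp

theorem continuous_soliton : Continuous soliton :=
  continuous_iff_continuousAt.2 fun y => (hasDerivAt_soliton y).continuousAt

theorem continuous_solitonDeriv : Continuous solitonDeriv := by
  unfold solitonDeriv
  refine (Continuous.div (by fun_prop) (by fun_prop) fun y => ?_).neg
  have := Real.cosh_pos (2 * y)
  positivity

theorem contDiff_soliton : ContDiff ℝ 1 soliton := by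
  rw [contDiff_one_iff_deriv]
  refine ⟨fun y => (hasDerivAt_soliton y).differentiableAt, ?_⟩
  rw [show deriv soliton = solitonDeriv from funext fun y => (hasDerivAt_soliton y).deriv]
  exact continuous_solitonDeriv

theorem solitonDeriv_sq (y : ℝ) : solitonDeriv y ^ 2 = soliton y ^ 2 - soliton y ^ 6 := by
  have hc := Real.cosh_pos (2 * y)
  have h6 : soliton y ^ 6 = ((Real.cosh (2 * y))⁻¹) ^ 3 := by rw [← soliton_sq]; ring
  rw [h6, soliton_sq, solitonDeriv, neg_sq, div_pow, mul_pow, Real.sq_sqrt hc.le, Real.sinh_sq]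
  field_simp

theorem integral_soliton_sq_le (r : ℝ) : ∫ y in (-r)..r, soliton y ^ 2 ≤ Real.pi / 2 := by
  have h : ∀ y ∈ uIcc (-r) r, HasDerivAt (fun y => 1 / 2 * Real.arctan (Real.sinh (2 * y)))
      (soliton y ^ 2) y := by
    intro y _
    have hc := Real.cosh_pos (2 * y)
    convert! ((hasDerivAt_sinh_two_mul y).arctan).const_mul (1 / 2) using 1
    rw [soliton_sq, ← Real.cosh_sq']
    field_simp
  rw [intervalIntegral.integral_eq_sub_of_hasDerivAt h
    ((continuous_soliton.pow 2).intervalIntegrable _ _), mul_neg, Real.sinh_neg, Real.arctan_neg]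
  linarith [Real.arctan_lt_pi_div_two (Real.sinh (2 * r))]

/-- The difference of the integrands has the explicit odd primitive `-soliton * solitonDeriv / 2`,
which is nonnegative at `r`. On the whole line this becomes the equality expressing that the soliton
has zero energy. -/
theorem integral_solitonDeriv_sq_le {r : ℝ} (hr : 0 ≤ r) :
    ∫ y in (-r)..r, solitonDeriv y ^ 2 ≤ ∫ y in (-r)..r, soliton y ^ 6 := by
  have h : ∀ y ∈ uIcc (-r) r,
      HasDerivAt (fun y => 1 / 2 * (Real.sinh (2 * y) / Real.cosh (2 * y) ^ 2))
      (soliton y ^ 6 - solitonDeriv y ^ 2) y := by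
    intro y _
    have hc := Real.cosh_pos (2 * y)
    convert! ((hasDerivAt_sinh_two_mul y).div ((hasDerivAt_cosh_two_mul y).pow 2)
      (pow_pos hc 2).ne').const_mul (1 / 2) using 1
    have h6 : soliton y ^ 6 = ((Real.cosh (2 * y))⁻¹) ^ 3 := by rw [← soliton_sq]; ring
    rw [solitonDeriv_sq, h6, soliton_sq]
    field_simp
    simp only [Nat.add_one_sub_one, pow_one, Pi.pow_apply]
    rw [Real.sinh_sq]
    push_cast
    field_simp
    ring
  have h1 := intervalIntegral.integral_eq_sub_of_hasDerivAt h
    (((continuous_soliton.pow 6).sub (continuous_solitonDeriv.pow 2)).intervalIntegrable _ _)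
  have i6 : IntervalIntegrable (fun y => soliton y ^ 6) volume (-r) r :=
    (continuous_soliton.pow 6).intervalIntegrable _ _
  have i2 : IntervalIntegrable (fun y => solitonDeriv y ^ 2) volume (-r) r :=
    (continuous_solitonDeriv.pow 2).intervalIntegrable _ _
  rw [intervalIntegral.integral_sub i6 i2, mul_neg, Real.sinh_neg,
    Real.cosh_neg] at h1
  have h2 : 0 ≤ Real.sinh (2 * r) / Real.cosh (2 * r) ^ 2 := by
    have := Real.sinh_nonneg_iff.2 (show 0 ≤ 2 * r by linarith)
    positivity
  rw [neg_div] at h1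
  linarith

/-- Bernoulli's inequality, in the form needed for the truncated soliton. -/
theorem sub_pow_six_ge {x e : ℝ} (he : 0 ≤ e) (hex : e ≤ x) (hx : x ≤ 1) :
    x ^ 6 - 6 * e * x ^ 2 ≤ (x - e) ^ 6 := by
  have hx0 : 0 ≤ x := he.trans hex
  have h1 : x ^ 6 - 6 * e * x ^ 5 ≤ (x - e) ^ 6 := by
    rcases hx0.eq_or_lt with h0 | h0
    · have : e = 0 := by linarith
      subst this; simp
    · have hb := one_add_mul_le_pow (a := -(e / x)) (by
        rw [neg_le_neg_iff, div_le_iff₀ h0]; linarith) 6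
      have h2 : (x - e) ^ 6 = x ^ 6 * (1 + -(e / x)) ^ 6 := by
        rw [← mul_pow]; congr 1; field_simp; ring
      have h3 : x ^ 6 - 6 * e * x ^ 5 = x ^ 6 * (1 + ((6 : ℕ) : ℝ) * -(e / x)) := by
        push_cast; field_simp; ring
      rw [h2, h3]
      exact mul_le_mul_of_nonneg_left hb (by positivity)
  have h2 : x ^ 5 ≤ x ^ 2 := pow_le_pow_of_le_one hx0 hx (by norm_num)
  nlinarith

/-! ### The soliton lowered by `soliton r`, so as to vanish at the endpoints of `[-r, r]` -/

section Truncated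

variable {r : ℝ}

theorem soliton_sub_mem {y : ℝ} (hr : 0 ≤ r) (hy : y ∈ Icc (-r) r) : soliton r ≤ soliton y :=
  soliton_le_of_abs_le (by rw [abs_of_nonneg hr]; exact abs_le.2 hy)

theorem integral_truncated_sq_le (hr : 0 ≤ r) :
    ∫ y in (-r)..r, (soliton y - soliton r) ^ 2 ≤ Real.pi / 2 := by
  refine le_trans ?_ (integral_soliton_sq_le r)
  refine intervalIntegral.integral_mono_on (by linarith)
    (((continuous_soliton.sub continuous_const).pow 2).intervalIntegrable _ _)
    ((continuous_soliton.pow 2).intervalIntegrable _ _) fun y hy => ?_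
  have := soliton_sub_mem hr hy
  have := soliton_pos r
  exact pow_le_pow_left₀ (by linarith) (by linarith) 2

theorem integral_truncated_pow_six_le (hr : 0 ≤ r) :
    ∫ y in (-r)..r, (soliton y - soliton r) ^ 6 ≤ ∫ y in (-r)..r, (soliton y - soliton r) ^ 2 := by
  refine intervalIntegral.integral_mono_on (by linarith)
    (((continuous_soliton.sub continuous_const).pow 6).intervalIntegrable _ _)
    (((continuous_soliton.sub continuous_const).pow 2).intervalIntegrable _ _) fun y hy => ?_
  have := soliton_sub_mem hr hy
  have := soliton_pos r
  exact pow_le_pow_of_le_one (by linarith) (by linarith [soliton_le_one y]) (by norm_num)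

/-- The truncation costs at most `6 * soliton r * ∫ soliton ^ 2` in the sextic term, by
`sub_pow_six_ge`, and the last integral is at most `π / 2`. -/
theorem integral_solitonDeriv_sq_sub_le (hr : 0 ≤ r) :
    (∫ y in (-r)..r, solitonDeriv y ^ 2) - ∫ y in (-r)..r, (soliton y - soliton r) ^ 6 ≤
      3 * Real.pi * soliton r := by
  have h1 : (∫ y in (-r)..r, (soliton y ^ 6 - 6 * soliton r * soliton y ^ 2)) ≤
      ∫ y in (-r)..r, (soliton y - soliton r) ^ 6 := by
    refine intervalIntegral.integral_mono_on (by linarith)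
      (((continuous_soliton.pow 6).sub ((continuous_soliton.pow 2).const_mul _)).intervalIntegrable
        _ _)
      (((continuous_soliton.sub continuous_const).pow 6).intervalIntegrable _ _) fun y hy => ?_
    exact sub_pow_six_ge (soliton_pos r).le (soliton_sub_mem hr hy) (soliton_le_one y)
  have i6 : IntervalIntegrable (fun y => soliton y ^ 6) volume (-r) r :=
    (continuous_soliton.pow 6).intervalIntegrable _ _
  have i2 : IntervalIntegrable (fun y => 6 * soliton r * soliton y ^ 2) volume (-r) r :=
    ((continuous_soliton.pow 2).const_mul _).intervalIntegrable _ _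
  rw [intervalIntegral.integral_sub i6 i2,
    intervalIntegral.integral_const_mul] at h1
  have h2 := integral_solitonDeriv_sq_le hr
  have h3 := mul_le_mul_of_nonneg_left (integral_soliton_sq_le r)
    (show 0 ≤ 6 * soliton r by linarith [soliton_pos r])
  linarith

theorem integral_solitonDeriv_sq_mono (hr : 1 ≤ r) :
    ∫ y in (-1 : ℝ)..1, solitonDeriv y ^ 2 ≤ ∫ y in (-r)..r, solitonDeriv y ^ 2 :=
  intervalIntegral.integral_mono_interval (by linarith) (by norm_num) hr
    (Eventually.of_forall fun y => sq_nonneg _)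
    ((continuous_solitonDeriv.pow 2).intervalIntegrable _ _)

theorem integral_solitonDeriv_sq_pos : 0 < ∫ y in (-1 : ℝ)..1, solitonDeriv y ^ 2 := by
  refine intervalIntegral.integral_pos (by norm_num)
    (continuous_solitonDeriv.pow 2).continuousOn (fun _ _ => sq_nonneg _) ⟨1, by norm_num, ?_⟩
  have h1 : 0 < Real.sinh (2 * 1) := Real.sinh_pos_iff.2 (by norm_num)
  have h2 := Real.cosh_pos (2 * 1)
  unfold solitonDeriv
  rw [neg_sq]
  positivity

/-- Exponential decay of the soliton beats the factor `r ^ 2` by which compression into a fixed edge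
multiplies the energy. -/
theorem tendsto_sq_mul_soliton : Tendsto (fun r => r ^ 2 * soliton r) atTop (𝓝 0) := by
  have h1 := (Real.tendsto_pow_mul_exp_neg_atTop_nhds_zero 2).mul_const (√2)
  rw [zero_mul] at h1
  refine squeeze_zero (fun r => mul_nonneg (sq_nonneg _) (soliton_pos r).le) (fun r => ?_) h1
  rw [mul_assoc]
  refine mul_le_mul_of_nonneg_left ?_ (sq_nonneg _)
  have h2 : Real.exp (r) / √2 ≤ √(Real.cosh (2 * r)) := by
    apply Real.le_sqrt_of_sq_le
    rw [div_pow, Real.sq_sqrt (by norm_num), ← Real.exp_nat_mul, Real.cosh_eq]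
    push_cast
    linarith [Real.exp_pos (-(2 * r))]
  have h3 : 0 < Real.exp r / √2 := by positivity
  calc soliton r ≤ (Real.exp r / √2)⁻¹ := by unfold soliton; gcongr
    _ = Real.exp (-r) * √2 := by rw [Real.exp_neg]; field_simp

end Truncated

set_option maxHeartbeats 1000000 in
/-- On a bounded interval there are functions, vanishing at the endpoints, of mass close to the
critical mass, of large kinetic term and of small energy. -/
theorem exists_concentrated {d K : ℝ} (hd : 0 < d) (hK : 0 < K) :
    ∀ᶠ μ in 𝓝[<] lineMass, ∃ w : ℝ → ℝ, MemH1On (Icc 0 d) w ∧ w 0 = 0 ∧ w d = 0 ∧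
      massOn (Icc 0 d) w = μ ∧ K ≤ kineticOn (Icc 0 d) w ∧
      1 / 2 * kineticOn (Icc 0 d) w - 1 / 6 * sexticOn (Icc 0 d) w < K / 4 := by
  set m := lineMass with hm
  have hm0 : 0 < m := lineMass_pos
  set T₁ := ∫ y in (-1 : ℝ)..1, solitonDeriv y ^ 2 with hT₁
  have hT₁pos : 0 < T₁ := integral_solitonDeriv_sq_pos
  have hpi := Real.pi_pos
  -- the choice of the truncation radius
  have ev : ∀ᶠ r : ℝ in atTop, 1 ≤ r ∧ 3 * Real.pi * (r ^ 2 * soliton r) ≤ T₁ / 2 ∧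
      (m / T₁) * (4 / d ^ 2) * (3 * Real.pi) * (r ^ 2 * soliton r) < K / 8 ∧
      K * d ^ 2 * Real.pi ≤ 4 * m * T₁ * r := by
    refine (eventually_ge_atTop 1).and (Eventually.and ?_ (Eventually.and ?_ ?_))
    · have := tendsto_sq_mul_soliton.const_mul (3 * Real.pi)
      rw [mul_zero] at this
      exact (this.eventually_lt_const (show 0 < T₁ / 2 by positivity)).mono fun _ h => h.le
    · have := tendsto_sq_mul_soliton.const_mul ((m / T₁) * (4 / d ^ 2) * (3 * Real.pi))
      rw [mul_zero] at this
      exact this.eventually_lt_const (by positivity)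
    · exact (tendsto_id.const_mul_atTop (show 0 < 4 * m * T₁ by positivity)).eventually_ge_atTop _
  obtain ⟨r, hr1, hrT, hrE, hrK⟩ := ev.exists
  have hr0 : 0 < r := by linarith
  set η := soliton r with hη
  have hη0 : 0 < η := soliton_pos r
  set lam := 2 * r / d with hlam
  have hlam0 : 0 < lam := by positivity
  have hlamd : lam * d = 2 * r := by rw [hlam]; field_simp
  set M := ∫ y in (-r)..r, (soliton y - η) ^ 2 with hM
  set T := ∫ y in (-r)..r, solitonDeriv y ^ 2 with hT
  set S := ∫ y in (-r)..r, (soliton y - η) ^ 6 with hS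
  have hMpi : M ≤ Real.pi / 2 := integral_truncated_sq_le hr0.le
  have hSM : S ≤ M := integral_truncated_pow_six_le hr0.le
  have hTS : T - S ≤ 3 * Real.pi * η := integral_solitonDeriv_sq_sub_le hr0.le
  have hTT : T₁ ≤ T := integral_solitonDeriv_sq_mono hr1
  have hT0 : 0 < T := hT₁pos.trans_le hTT
  have hS0 : 0 ≤ S := intervalIntegral.integral_nonneg (by linarith) fun y _ => by positivity
  have hηT : 3 * Real.pi * η ≤ T₁ / 2 := by
    refine le_trans ?_ hrT
    have : η ≤ r ^ 2 * η := le_mul_of_one_le_left hη0.le (one_le_pow₀ hr1)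
    gcongr
  -- Since `M ≥ S ≥ T - 3 * π * η ≥ T₁ / 2`, the factor `1 / M` is bounded independently of `r`.
  have hMT : T₁ / 2 ≤ M := by linarith
  have hM0 : 0 < M := by linarith
  -- the mass is close to the critical mass
  have hcont : Tendsto (fun μ : ℝ => (m / T₁) * lam ^ 2 * (Real.pi / 2) * (1 - μ ^ 2 / m ^ 2))
      (𝓝[<] m) (𝓝 0) := by
    have : Continuous fun μ : ℝ => (m / T₁) * lam ^ 2 * (Real.pi / 2) * (1 - μ ^ 2 / m ^ 2) := by
      fun_prop
    have h := this.tendsto m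
    rw [div_self (pow_pos hm0 2).ne', sub_self, mul_zero] at h
    exact h.mono_left nhdsWithin_le_nhds
  filter_upwards [hcont.eventually_lt_const (show 0 < K / 8 by positivity),
    (eventually_gt_nhds (show m / 2 < m by linarith)).filter_mono nhdsWithin_le_nhds,
    self_mem_nhdsWithin] with μ hμE hμ2 hμm
  have hμ0 : 0 < μ := by linarith
  have hμm : μ < m := hμm
  -- The map `x ↦ lam * x - r` sends `[0, d]` onto `[-r, r]`, and this amplitude makes the mass
  -- equal to `μ`.
  set a := √(μ * lam / M) with ha
  have ha2 : a ^ 2 = μ * lam / M := Real.sq_sqrt (by positivity)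
  have hder : ∀ y, HasDerivAt (fun y => soliton y - η) (solitonDeriv y) y := fun y =>
    (hasDerivAt_soliton y).sub_const η
  have emass := massOn_scaling (fun y => soliton y - η) a hd hlam0 hlamd
  have ekin := kineticOn_scaling hder a hd hlam0 hlamd
  have esex := sexticOn_scaling (fun y => soliton y - η) a hd hlam0 hlamd
  have ekin' : a ^ 2 * lam * T = μ * lam ^ 2 * T / M := by rw [ha2]; field_simp
  have esex' : a ^ 6 * lam⁻¹ * S = μ ^ 3 * lam ^ 2 * S / M ^ 3 := by
    rw [show a ^ 6 = (a ^ 2) ^ 3 by ring, ha2]; field_simp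
  refine ⟨fun x => a * (soliton (lam * x - r) - η), ?_, ?_, ?_, ?_, ?_, ?_⟩
  · apply MemH1On.of_contDiff_Icc
    exact contDiff_const.mul ((contDiff_soliton.comp ((contDiff_const.mul contDiff_id).sub
      contDiff_const)).sub contDiff_const)
  · simp [soliton_neg, hη]
  · simp only [hlamd, show 2 * r - r = r by ring, hη, sub_self, mul_zero]
  · rw [emass, ← hM, ha2]; field_simp
  · rw [ekin, ← hT, ekin']
    rw [le_div_iff₀ hM0]
    have h1 : lam ^ 2 = 4 * r ^ 2 / d ^ 2 := by rw [hlam]; ring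
    rw [h1, ← mul_div_assoc, div_mul_eq_mul_div, le_div_iff₀ (by positivity)]
    have h2 : K * M * d ^ 2 ≤ K * (Real.pi / 2) * d ^ 2 := by gcongr
    have h3 : 4 * m * T₁ * r ≤ 4 * (2 * μ) * T * r ^ 2 := by
      have h4 : r ≤ r ^ 2 := by nlinarith
      have h5 : 4 * m * T₁ ≤ 4 * (2 * μ) * T :=
        mul_le_mul (by linarith) hTT hT₁pos.le (by positivity)
      exact mul_le_mul h5 h4 hr0.le (by positivity)
    linarith
  · rw [ekin, esex, ← hT, ← hS, ekin', esex']
    -- Only the lower bound for `m` is used: it gives `3 * M ^ 2 ≤ m ^ 2`, and a larger `m` would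
    -- only lower the energy.
    have h1 : μ ^ 2 / m ^ 2 * S ≤ μ ^ 2 * S / (3 * M ^ 2) := by
      have h2 : 3 * M ^ 2 ≤ m ^ 2 := by
        have h3 : (√3 * Real.pi / 2) ^ 2 ≤ m ^ 2 :=
          pow_le_pow_left₀ (by positivity) soliton_mass_le_realLine_criticalMass 2
        rw [div_pow, mul_pow, Real.sq_sqrt (by norm_num)] at h3
        have h4 : M ^ 2 ≤ (Real.pi / 2) ^ 2 := pow_le_pow_left₀ hM0.le hMpi 2
        linarith
      rw [div_mul_eq_mul_div]
      gcongr
    have hq : μ ^ 2 / m ^ 2 ≤ 1 := by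
      rw [div_le_one (by positivity)]
      exact pow_le_pow_left₀ hμ0.le hμm.le 2
    have h2 : T - μ ^ 2 * S / (3 * M ^ 2) ≤
        3 * Real.pi * η + Real.pi / 2 * (1 - μ ^ 2 / m ^ 2) := by
      have h3 := mul_le_mul_of_nonneg_left (hSM.trans hMpi) (sub_nonneg.2 hq)
      rw [sub_mul, one_mul] at h3
      linarith
    have h3 : 0 ≤ 3 * Real.pi * η + Real.pi / 2 * (1 - μ ^ 2 / m ^ 2) := by
      have := mul_nonneg (show 0 ≤ Real.pi / 2 by positivity) (sub_nonneg.2 hq)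
      positivity
    have h4 : μ * lam ^ 2 / (2 * M) ≤ m / T₁ * lam ^ 2 := by
      rw [div_mul_eq_mul_div]
      gcongr
      linarith
    calc 1 / 2 * (μ * lam ^ 2 * T / M) - 1 / 6 * (μ ^ 3 * lam ^ 2 * S / M ^ 3)
        = μ * lam ^ 2 / (2 * M) * (T - μ ^ 2 * S / (3 * M ^ 2)) := by field_simp; ring
      _ ≤ μ * lam ^ 2 / (2 * M) * (3 * Real.pi * η + Real.pi / 2 * (1 - μ ^ 2 / m ^ 2)) := by
          gcongr
      _ ≤ m / T₁ * lam ^ 2 * (3 * Real.pi * η + Real.pi / 2 * (1 - μ ^ 2 / m ^ 2)) := by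
          gcongr
      _ = m / T₁ * (4 / d ^ 2) * (3 * Real.pi) * (r ^ 2 * η)
          + m / T₁ * lam ^ 2 * (Real.pi / 2) * (1 - μ ^ 2 / m ^ 2) := by
          rw [hlam]; ring
      _ < K / 4 := by linarith

/-! ### Weak compactness -/

theorem inner_L2_eq {μ : Measure ℝ} (p q : Lp ℝ 2 μ) : inner ℝ p q = ∫ x, p x * q x ∂μ := by
  rw [L2.inner_def]
  simp [mul_comm]

theorem norm_toLp_two_le {μ : Measure ℝ} {f : ℝ → ℝ} {C : ℝ} (hf : MemLp f 2 μ)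
    (hC : ∫ x, f x ^ 2 ∂μ ≤ C) : ‖hf.toLp f‖ ≤ √C := by
  apply Real.le_sqrt_of_sq_le
  rw [← real_inner_self_eq_norm_sq, inner_L2_eq]
  refine le_trans (le_of_eq ?_) hC
  refine integral_congr_ae ?_
  filter_upwards [hf.coeFn_toLp] with y hy
  rw [hy, sq]

/-- Bounded sequences in `L²` have weakly convergent subsequences. -/
theorem exists_weak_limit {μ : Measure ℝ} [SFinite μ] {g : ℕ → ℝ → ℝ} {C : ℝ}
    (hg : ∀ n, MemLp (g n) 2 μ) (hC : ∀ n, ∫ x, g n x ^ 2 ∂μ ≤ C) :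
    ∃ φ : ℕ → ℕ, StrictMono φ ∧ ∃ G : ℝ → ℝ, MemLp G 2 μ ∧ ∀ h : ℝ → ℝ, MemLp h 2 μ →
      Tendsto (fun n => ∫ x, g (φ n) x * h x ∂μ) atTop (𝓝 (∫ x, G x * h x ∂μ)) := by
  set x : ℕ → Lp ℝ 2 μ := fun n => (hg n).toLp (g n)
  have hx : ∀ n, ‖x n‖ ≤ √C := fun n => norm_toLp_two_le (hg n) (hC n)
  set X : ℕ → WeakDual ℝ (Lp ℝ 2 μ) := fun n =>
    StrongDual.toWeakDual (InnerProductSpace.toDual ℝ (Lp ℝ 2 μ) (x n))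
  have : Fact ((2 : ENNReal) ≠ ⊤) := ⟨ENNReal.ofNat_ne_top⟩
  -- Sequential Banach-Alaoglu in the dual of `L²`, combined with the Riesz isometry.
  obtain ⟨F, -, φ, hφ, hlim⟩ := WeakDual.isSeqCompact_closedBall ℝ (Lp ℝ 2 μ)
    (0 : StrongDual ℝ (Lp ℝ 2 μ)) (√C) (x := X) (fun n => by
      simp only [mem_preimage, mem_closedBall_zero_iff, X]
      change ‖InnerProductSpace.toDual ℝ (Lp ℝ 2 μ) (x n)‖ ≤ √C
      rw [LinearIsometryEquiv.norm_map]
      exact hx n)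
  set G : Lp ℝ 2 μ := (InnerProductSpace.toDual ℝ (Lp ℝ 2 μ)).symm (WeakDual.toStrongDual F)
  refine ⟨φ, hφ, G, Lp.memLp G, fun h hh => ?_⟩
  have h1 := (WeakDual.eval_continuous (hh.toLp h)).tendsto F |>.comp hlim
  have e1 : F (hh.toLp h) = ∫ x, G x * h x ∂μ := by
    have : F (hh.toLp h) = inner ℝ G (hh.toLp h) :=
      (InnerProductSpace.toDual_symm_apply (y := WeakDual.toStrongDual F)).symm
    rw [this, inner_L2_eq]
    refine integral_congr_ae ?_
    filter_upwards [hh.coeFn_toLp] with y hy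
    rw [hy]
  have e2 : ∀ n, X n (hh.toLp h) = ∫ x, g n x * h x ∂μ := by
    intro n
    have : X n (hh.toLp h) = inner ℝ (x n) (hh.toLp h) := InnerProductSpace.toDual_apply_apply
    rw [this, inner_L2_eq]
    refine integral_congr_ae ?_
    filter_upwards [hh.coeFn_toLp, (hg n).coeFn_toLp] with y hy hy'
    rw [hy, hy']
  rw [← e1]
  refine h1.congr fun n => ?_
  exact e2 (φ n)

/-- The pointwise limit of a sequence that is bounded in `L²` is square integrable. -/
theorem memLp_two_of_tendsto {μ : Measure ℝ} {F : ℕ → ℝ → ℝ} {f : ℝ → ℝ} {C : ℝ}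
    (hF : ∀ n, MemLp (F n) 2 μ) (hC : ∀ n, ∫ x, F n x ^ 2 ∂μ ≤ C)
    (hlim : ∀ᵐ x ∂μ, Tendsto (fun n => F n x) atTop (𝓝 (f x))) : MemLp f 2 μ := by
  refine ⟨aestronglyMeasurable_of_tendsto_ae atTop (fun n => (hF n).1) hlim, ?_⟩
  refine lt_of_le_of_lt (Lp.eLpNorm_le_of_ae_tendsto (u := atTop) (C := ENNReal.ofReal (√C))
    (Eventually.of_forall fun n => ?_) (fun n => (hF n).1) hlim) ENNReal.ofReal_lt_top
  rw [ENNReal.le_ofReal_iff_toReal_le (hF n).2.ne (Real.sqrt_nonneg _), ← Lp.norm_toLp _ (hF n)]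
  exact norm_toLp_two_le (hF n) (hC n)

/-- The sequence `F` of `H¹` functions on `s` converges to `f` pointwise, and its derivatives
converge weakly in `L²`. -/
structure WeakLimit (s : Set ℝ) (F : ℕ → ℝ → ℝ) (f : ℝ → ℝ) : Prop where
  mem : ∀ n, MemH1On s (F n)
  mem_limit : MemH1On s f
  bounded : ∃ C, ∀ n, ∀ x ∈ s, |F n x| ≤ C
  tendsto : ∀ x ∈ s, Tendsto (fun n => F n x) atTop (𝓝 (f x))
  tendsto_deriv : ∀ h : ℝ → ℝ, MemLp h 2 (volume.restrict s) →
    Tendsto (fun n => ∫ x in s, deriv (F n) x * h x) atTop (𝓝 (∫ x in s, deriv f x * h x))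

theorem WeakLimit.comp {s : Set ℝ} {F : ℕ → ℝ → ℝ} {f : ℝ → ℝ} (h : WeakLimit s F f)
    {φ : ℕ → ℕ} (hφ : StrictMono φ) : WeakLimit s (fun n => F (φ n)) f where
  mem n := h.mem (φ n)
  mem_limit := h.mem_limit
  bounded := h.bounded.imp fun _ hC n => hC (φ n)
  tendsto x hx := (h.tendsto x hx).comp hφ.tendsto_atTop
  tendsto_deriv g hg := (h.tendsto_deriv g hg).comp hφ.tendsto_atTop

theorem setIntegral_mul_indicator_one {s : Set ℝ} (hs : IsEdge s) (g : ℝ → ℝ) {x : ℝ}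
    (hx : x ∈ s) : ∫ y in s, g y * (Icc 0 x).indicator 1 y = ∫ y in (0 : ℝ)..x, g y := by
  have h0 := hs.nonneg hx
  have hsub : Icc 0 x ⊆ s := by simpa [uIcc_of_le h0] using hs.uIcc_subset hs.zero_mem hx
  have e : (fun y => g y * (Icc 0 x).indicator 1 y) = (Icc 0 x).indicator g := by
    funext y
    by_cases hy : y ∈ Icc 0 x <;> simp [hy]
  rw [e, setIntegral_indicator measurableSet_Icc, inter_eq_self_of_subset_right hsub,
    intervalIntegral.integral_of_le h0, integral_Icc_eq_integral_Ioc]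

/-- Bounded sequences in `H¹` of an edge have weakly convergent subsequences. -/
theorem exists_weakLimit {s : Set ℝ} (hs : IsEdge s) {F : ℕ → ℝ → ℝ} {M T : ℝ}
    (hF : ∀ n, MemH1On s (F n)) (hM : ∀ n, massOn s (F n) ≤ M)
    (hT : ∀ n, kineticOn s (F n) ≤ T) :
    ∃ φ : ℕ → ℕ, StrictMono φ ∧ ∃ f, WeakLimit s (fun n => F (φ n)) f := by
  obtain ⟨d, hd, hw⟩ := hs.exists_hasWidth
  set C := √(M / d) + √(d * T) with hC
  have hb : ∀ n, ∀ x ∈ s, |F n x| ≤ C := fun n x hx => by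
    refine ((hF n).abs_le hs hd hw hx).trans (add_le_add (Real.sqrt_le_sqrt ?_)
      (Real.sqrt_le_sqrt ?_))
    · gcongr; exact hM n
    · gcongr; exact hT n
  obtain ⟨φ, hφ, g, hg, hlim⟩ := exists_weak_limit (fun n => (hF n).memLp_deriv) (C := T)
    (fun n => by simpa only [kineticOn, sq_abs] using hT n)
  obtain ⟨c, -, ψ, hψ, hc⟩ := (isCompact_Icc (a := -C) (b := C)).tendsto_subseq
    (x := fun n => F (φ n) 0) fun n => abs_le.1 (hb _ 0 hs.zero_mem)
  set f : ℝ → ℝ := fun x => c + ∫ t in (0 : ℝ)..x, g t with hf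
  have hpt : ∀ x ∈ s, Tendsto (fun n => F (φ (ψ n)) x) atTop (𝓝 (f x)) := by
    intro x hx
    -- Testing the weak convergence of the derivatives against the indicator of `[0, x]` gives
    -- convergence of `F n x - F n 0`; with convergence at `0` this yields the limit at every point.
    have hfin : MemLp ((Icc 0 x).indicator (1 : ℝ → ℝ)) 2 (volume.restrict s) :=
      memLp_indicator_const 2 measurableSet_Icc (1 : ℝ) (Or.inr (ne_of_lt
        ((Measure.restrict_apply_le _ _).trans_lt (by simp))))
    have h1 := ((hlim _ hfin).comp hψ.tendsto_atTop)
    rw [setIntegral_mul_indicator_one hs g hx] at h1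
    refine (hc.add h1).congr fun n => ?_
    simp only [Function.comp_apply]
    rw [setIntegral_mul_indicator_one hs _ hx, (hF _).intervalIntegral_deriv hs.zero_mem hx]
    ring
  have hf2 : MemLp f 2 (volume.restrict s) :=
    memLp_two_of_tendsto (fun n => (hF (φ (ψ n))).memLp)
      (fun n => by simpa only [massOn, sq_abs] using hM (φ (ψ n)))
      ((ae_restrict_iff' hs.measurableSet).2 (Eventually.of_forall hpt))
  have hd' := (ac_and_deriv_of_primitive hs hg (f := f) (c := c) fun x _ => rfl).2
  refine ⟨φ ∘ ψ, hφ.comp hψ, f, ⟨fun n => hF _, MemH1On.of_primitive hs hg (fun x _ => rfl) hf2,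
    ⟨C, fun n => hb _⟩, hpt, fun h hh => ?_⟩⟩
  have e : ∫ x in s, deriv f x * h x = ∫ x in s, g x * h x := by
    refine integral_congr_ae ?_
    filter_upwards [hd'] with x hx
    rw [hx]
  rw [e]
  exact (hlim h hh).comp hψ.tendsto_atTop

/-- Simultaneous extraction of subsequences for finitely many indices. -/
theorem exists_subseq_forall {ι : Type*} [Finite ι] (Q : ι → (ℕ → ℕ) → Prop)
    (hsub : ∀ (i : ι) (φ ψ : ℕ → ℕ), StrictMono φ → StrictMono ψ → Q i φ → Q i (φ ∘ ψ))
    (hex : ∀ (i : ι) (φ : ℕ → ℕ), StrictMono φ → ∃ ψ : ℕ → ℕ, StrictMono ψ ∧ Q i (φ ∘ ψ)) :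
    ∃ φ : ℕ → ℕ, StrictMono φ ∧ ∀ i, Q i φ := by
  classical
  have := Fintype.ofFinite ι
  have key : ∀ t : Finset ι, ∃ φ : ℕ → ℕ, StrictMono φ ∧ ∀ i ∈ t, Q i φ := by
    intro t
    induction t using Finset.induction_on with
    | empty => exact ⟨id, strictMono_id, by simp⟩
    | insert i t _ ih =>
      obtain ⟨φ, hφ, h⟩ := ih
      obtain ⟨ψ, hψ, h'⟩ := hex i φ hφ
      refine ⟨φ ∘ ψ, hφ.comp hψ, fun j hj => ?_⟩
      rcases Finset.mem_insert.1 hj with rfl | hj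
      · exact h'
      · exact hsub j φ ψ hφ hψ (h j hj)
  obtain ⟨φ, hφ, h⟩ := key Finset.univ
  exact ⟨φ, hφ, fun i => h i (Finset.mem_univ i)⟩

namespace WeakLimit

variable {s : Set ℝ} {F : ℕ → ℝ → ℝ} {f : ℝ → ℝ}

/-- Convergence of the integral of a power on a bounded part of the edge. -/
theorem tendsto_integral_pow (hs : IsEdge s) (h : WeakLimit s F f) {R : ℝ} (hR : Icc 0 R ⊆ s)
    (k : ℕ) : Tendsto (fun n => ∫ x in Icc 0 R, |F n x| ^ k) atTop
      (𝓝 (∫ x in Icc 0 R, |f x| ^ k)) := by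
  obtain ⟨C, hC⟩ := h.bounded
  refine tendsto_integral_of_dominated_convergence (fun _ => C ^ k) (fun n => ?_)
    (integrable_const _) (fun n => ?_) ?_
  · exact ((((h.mem n).continuousOn hs).mono hR).abs.pow k).aestronglyMeasurable measurableSet_Icc
  · refine (ae_restrict_iff' measurableSet_Icc).2 (Eventually.of_forall fun x hx => ?_)
    rw [Real.norm_of_nonneg (by positivity)]
    exact pow_le_pow_left₀ (abs_nonneg _) (hC n x (hR hx)) k
  · refine (ae_restrict_iff' measurableSet_Icc).2 (Eventually.of_forall fun x hx => ?_)
    exact (h.tendsto x (hR hx)).abs.pow k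

/-- Weak lower semicontinuity of the kinetic term on a part of the edge. -/
theorem exists_lower_kinetic (h : WeakLimit s F f) {A : Set ℝ} (hA : A ⊆ s)
    (hAm : MeasurableSet A) :
    ∃ k : ℕ → ℝ, Tendsto k atTop (𝓝 (kineticOn A f)) ∧ ∀ n, k n ≤ kineticOn A (F n) := by
  have hfA : MemLp (A.indicator (deriv f)) 2 (volume.restrict s) :=
    h.mem_limit.memLp_deriv.indicator hAm
  have e : ∀ g : ℝ → ℝ, ∫ x in s, g x * A.indicator (deriv f) x = ∫ x in A, g x * deriv f x := by
    intro g
    have e1 : (fun x => g x * A.indicator (deriv f) x) = A.indicator fun x => g x * deriv f x := by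
      funext x
      by_cases hx : x ∈ A <;> simp [hx]
    rw [e1, setIntegral_indicator hAm, inter_eq_self_of_subset_right hA]
  have h1 := h.tendsto_deriv _ hfA
  simp only [e] at h1
  -- The expression is linear in `F n`, hence convergent, and lies below the kinetic term because
  -- `(deriv (F n) - deriv f) ^ 2 ≥ 0`. Convergent minorants, unlike lower limits, can be summed
  -- over the edges directly.
  refine ⟨fun n => 2 * (∫ x in A, deriv (F n) x * deriv f x) - kineticOn A f, ?_, fun n => ?_⟩
  · have h2 := (h1.const_mul 2).sub_const (kineticOn A f)
    have e2 : 2 * (∫ x in A, deriv f x * deriv f x) - kineticOn A f = kineticOn A f := by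
      have : kineticOn A f = ∫ x in A, deriv f x * deriv f x := by
        simp only [kineticOn, sq, abs_mul_abs_self]
      rw [this]; ring
    rwa [e2] at h2
  · have hle : volume.restrict A ≤ volume.restrict s := Measure.restrict_mono hA le_rfl
    have m1 := (h.mem n).memLp_deriv.mono_measure hle
    have m2 := h.mem_limit.memLp_deriv.mono_measure hle
    have i1 := m1.integrable_mul_of_two m2
    have i2 := (h.mem_limit.integrableOn_deriv_sq).mono_set hA
    have i3 := ((h.mem n).integrableOn_deriv_sq).mono_set hA
    simp only [kineticOn]
    rw [← integral_const_mul, ← integral_sub (i1.const_mul 2) i2]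
    refine integral_mono ((i1.const_mul 2).sub i2) i3 fun x => ?_
    simp only [sq_abs]
    nlinarith [sq_nonneg (deriv (F n) x - deriv f x)]

/-- The mass of the limit is at most the limit of the masses. -/
theorem massOn_le (hs : IsEdge s) (h : WeakLimit s F f) {C : ℝ} (hC : ∀ n, massOn s (F n) ≤ C) :
    massOn s f ≤ C := by
  have key : ∀ R, Icc 0 R ⊆ s → massOn (Icc 0 R) f ≤ C := fun R hR =>
    le_of_tendsto' (h.tendsto_integral_pow hs hR 2) fun n =>
      (setIntegral_mono_set (h.mem n).integrableOn_sq (Eventually.of_forall fun x => by positivity)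
        (Eventually.of_forall hR)).trans (hC n)
  rcases hs with ⟨d, hd, rfl⟩ | rfl
  · exact key d le_rfl
  · exact le_of_tendsto' (tendsto_setIntegral_Icc_atTop h.mem_limit.integrableOn_sq) fun R =>
      key R Icc_subset_Ici_self

end WeakLimit

/-! ### Lower semicontinuity of the energy -/

/-- The energy on `A`, with a multiple of the kinetic term subtracted. -/
noncomputable def reducedEnergyOn (θ : ℝ) (A : Set ℝ) (f : ℝ → ℝ) : ℝ :=
  (1 / 2 - θ) * kineticOn A f - 1 / 6 * sexticOn A f

theorem WeakLimit.exists_lower_reducedEnergy {s : Set ℝ} {F : ℕ → ℝ → ℝ} {f : ℝ → ℝ} {θ : ℝ}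
    (hs : IsEdge s) (h : WeakLimit s F f) (hθ : θ ≤ 5 / 18) {R : ℝ} (hR : Icc 0 R ⊆ s) :
    ∃ k : ℕ → ℝ, Tendsto k atTop (𝓝 (reducedEnergyOn θ (Icc 0 R) f)) ∧
      ∀ n, k n ≤ reducedEnergyOn θ (Icc 0 R) (F n) := by
  obtain ⟨k, hk, hle⟩ := h.exists_lower_kinetic hR measurableSet_Icc
  refine ⟨fun n => (1 / 2 - θ) * k n - 1 / 6 * sexticOn (Icc 0 R) (F n),
    (hk.const_mul _).sub ((h.tendsto_integral_pow hs hR 6).const_mul _), fun n => ?_⟩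
  have := mul_le_mul_of_nonneg_left (hle n) (show 0 ≤ 1 / 2 - θ by linarith)
  unfold reducedEnergyOn
  linarith

/-- The threshold is `5 / 18 = 1 / 2 - 1 / 6 * (4 / 3)`, with `4 / 3` from `sexticOn_tail_le`. -/
theorem reducedEnergyOn_tail_nonneg {f : ℝ → ℝ} {θ R : ℝ} (hθ : θ ≤ 5 / 18)
    (hf : MemH1On (Ici 0) f) (hR : 0 ≤ R) (hm : massOn (Ici 0) f ≤ lineMass / 3) :
    0 ≤ reducedEnergyOn θ (Ici R) f := by
  have h1 : massOn (Ici R) f ≤ massOn (Ici 0) f :=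
    setIntegral_mono_set hf.integrableOn_sq (Eventually.of_forall fun x => by positivity)
      (Eventually.of_forall (Ici_subset_Ici.2 hR))
  have h2 := sexticOn_tail_le hf hR (h1.trans hm)
  have h3 := kineticOn_nonneg (Ici R) f
  unfold reducedEnergyOn
  nlinarith

theorem reducedEnergyOn_Ici_eq_add {f : ℝ → ℝ} (θ : ℝ) {R : ℝ} (hf : MemH1On (Ici 0) f)
    (hR : 0 ≤ R) : reducedEnergyOn θ (Ici 0) f =
      reducedEnergyOn θ (Icc 0 R) f + reducedEnergyOn θ (Ici R) f := by
  simp only [reducedEnergyOn, kineticOn, sexticOn]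
  rw [setIntegral_Ici_eq_add hf.integrableOn_deriv_sq hR,
    setIntegral_Ici_eq_add (hf.integrableOn_sextic isEdge_Ici) hR]
  ring

namespace MetricGraph

variable {V B L : Type*}

/-- The part of an edge at distance at most `R` from its origin, for half-lines, and the whole
edge, for bounded edges. -/
def cutEdge (G : MetricGraph V B L) (R : ℝ) : B ⊕ L → Set ℝ
  | Sum.inl b => Icc 0 (G.len b)
  | Sum.inr _ => Icc 0 R

variable [Fintype B] [Fintype L]

theorem energy_sub_eq (G : MetricGraph V B L) (θ : ℝ) (u : B ⊕ L → ℝ → ℝ) :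
    G.energy u - θ * G.kinetic u = ∑ e, reducedEnergyOn θ (G.edge e) (u e) := by
  simp only [reducedEnergyOn, Finset.sum_sub_distrib, ← Finset.mul_sum, ← kinetic_eq, ← sextic_eq,
    energy]
  ring

/-- Lower semicontinuity of the energy along weakly convergent sequences with little mass on every
half-line. -/
theorem energy_sub_le_of_weakLimit (G : MetricGraph V B L) {θ c : ℝ} (hθ : θ ≤ 5 / 18)
    {u : ℕ → B ⊕ L → ℝ → ℝ} {w : B ⊕ L → ℝ → ℝ} {E : ℕ → ℝ}
    (hlim : ∀ e, WeakLimit (G.edge e) (fun n => u n e) (w e))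
    (hm : ∀ n l, massOn (Ici 0) (u n (Sum.inr l)) ≤ lineMass / 3)
    (hE : ∀ n, G.energy (u n) - θ * G.kinetic (u n) ≤ E n) (hEc : Tendsto E atTop (𝓝 c)) :
    G.energy w - θ * G.kinetic w ≤ c := by
  -- On the part cut at `R` the sextic term converges and the kinetic term is lower semicontinuous.
  -- The discarded tails of `u n` contribute nonnegatively, so the bound is uniform in `R`, and `R`
  -- then tends to infinity.
  have key : ∀ R, 0 ≤ R → ∑ e, reducedEnergyOn θ (G.cutEdge R e) (w e) ≤ c := by
    intro R hR
    have hk : ∀ e, ∃ k : ℕ → ℝ, Tendsto k atTop (𝓝 (reducedEnergyOn θ (G.cutEdge R e) (w e))) ∧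
        ∀ n, k n ≤ reducedEnergyOn θ (G.cutEdge R e) (u n e) := by
      rintro (b | l)
      · exact (hlim (Sum.inl b)).exists_lower_reducedEnergy (G.isEdge (Sum.inl b)) hθ le_rfl
      · exact (hlim (Sum.inr l)).exists_lower_reducedEnergy (G.isEdge (Sum.inr l)) hθ
          Icc_subset_Ici_self
    choose k hk hle using hk
    refine le_of_tendsto_of_tendsto' (tendsto_finsetSum Finset.univ fun e _ => hk e) hEc fun n => ?_
    refine (Finset.sum_le_sum fun e _ => hle e n).trans (le_trans ?_ (hE n))
    rw [energy_sub_eq]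
    refine Finset.sum_le_sum fun e _ => ?_
    rcases e with b | l
    · exact le_rfl
    · have hmem : MemH1On (Ici 0) (u n (Sum.inr l)) := (hlim (Sum.inr l)).mem n
      change reducedEnergyOn θ (Icc 0 R) _ ≤ reducedEnergyOn θ (Ici 0) _
      rw [reducedEnergyOn_Ici_eq_add θ hmem hR]
      linarith [reducedEnergyOn_tail_nonneg hθ hmem hR (hm n l)]
  rw [energy_sub_eq]
  have ht : Tendsto (fun R => ∑ e, reducedEnergyOn θ (G.cutEdge R e) (w e)) atTop
      (𝓝 (∑ e, reducedEnergyOn θ (G.edge e) (w e))) := by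
    refine tendsto_finsetSum _ fun e _ => ?_
    rcases e with b | l
    · exact tendsto_const_nhds
    · have hmem : MemH1On (Ici 0) (w (Sum.inr l)) := (hlim (Sum.inr l)).mem_limit
      exact ((tendsto_setIntegral_Icc_atTop hmem.integrableOn_deriv_sq).const_mul _).sub
        ((tendsto_setIntegral_Icc_atTop (hmem.integrableOn_sextic isEdge_Ici)).const_mul _)
  refine le_of_tendsto ht ?_
  filter_upwards [eventually_ge_atTop 0] with R hR using key R hR

/-- A bounded sequence in `H¹(G)` has a subsequence that converges weakly on every edge to a
function in `H¹(G)`. -/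
theorem exists_weakLimit (G : MetricGraph V B L) {u : ℕ → B ⊕ L → ℝ → ℝ} {M T : ℝ}
    (hu : ∀ n, u n ∈ G.H1) (hM : ∀ n, G.mass (u n) ≤ M) (hT : ∀ n, G.kinetic (u n) ≤ T) :
    ∃ φ : ℕ → ℕ, StrictMono φ ∧ ∃ w ∈ G.H1,
      ∀ e, WeakLimit (G.edge e) (fun n => u (φ n) e) (w e) := by
  obtain ⟨φ, hφ, h⟩ := exists_subseq_forall
    (fun e φ => ∃ f, WeakLimit (G.edge e) (fun n => u (φ n) e) f)
    (fun e φ ψ _ hψ ⟨f, hf⟩ => ⟨f, hf.comp hψ⟩)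
    (fun e φ _ => by
      obtain ⟨ψ, hψ, f, hf⟩ := _root_.exists_weakLimit (G.isEdge e) (F := fun n => u (φ n) e)
        (fun n => (hu (φ n)).1 e) (fun n => (G.massOn_le_mass _ e).trans (hM (φ n)))
        (fun n => (G.kineticOn_le_kinetic _ e).trans (hT (φ n)))
      exact ⟨ψ, hψ, f, hf⟩)
  choose w hw using h
  choose h hb hl using fun n => (hu n).2
  -- The vertex values of the limit are limits along any incident edge; at a vertex without edges
  -- `limUnder` may be arbitrary.
  refine ⟨φ, hφ, w, ⟨fun e => (hw e).mem_limit, fun v => limUnder atTop fun n => h (φ n) v,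
    fun b => ⟨?_, ?_⟩, fun l => ?_⟩, hw⟩
  · have := (hw (Sum.inl b)).tendsto 0 (G.isEdge _).zero_mem
    simp only [(hb _ b).1] at this
    exact this.limUnder_eq.symm
  · have := (hw (Sum.inl b)).tendsto (G.len b) (right_mem_Icc.2 (G.len_pos b).le)
    simp only [(hb _ b).2] at this
    exact this.limUnder_eq.symm
  · have := (hw (Sum.inr l)).tendsto 0 (G.isEdge _).zero_mem
    simp only [hl _ l] at this
    exact this.limUnder_eq.symm

end MetricGraph

/-! ### Expansions along a line -/

section Expansion

variable {s : Set ℝ} {f g : ℝ → ℝ}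

theorem massOn_add_smul (hf : MemH1On s f) (hg : MemH1On s g) (t : ℝ) :
    massOn s (f + t • g) = massOn s f + 2 * t * (∫ x in s, f x * g x) + t ^ 2 * massOn s g := by
  have i1 := hf.integrableOn_sq
  have i2 := (hf.integrableOn_mul hg).const_mul (2 * t)
  have i3 := hg.integrableOn_sq.const_mul (t ^ 2)
  have i12 : IntegrableOn (fun x => |f x| ^ 2 + 2 * t * (f x * g x)) s := i1.add i2
  rw [massOn, massOn, massOn, ← integral_const_mul, ← integral_const_mul, ← integral_add i1 i2,
    ← integral_add i12 i3]
  congr 1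
  funext x
  simp only [sq_abs, Pi.add_apply, Pi.smul_apply, smul_eq_mul]
  ring

theorem kineticOn_add_smul (hs : IsEdge s) (hf : MemH1On s f) (hg : MemH1On s g) (t : ℝ) :
    kineticOn s (f + t • g) =
      kineticOn s f + 2 * t * (∫ x in s, deriv f x * deriv g x) + t ^ 2 * kineticOn s g := by
  have i1 := hf.integrableOn_deriv_sq
  have i2 := (hf.memLp_deriv.integrable_mul_of_two hg.memLp_deriv).const_mul (2 * t)
  have i3 := hg.integrableOn_deriv_sq.const_mul (t ^ 2)
  have i12 : IntegrableOn (fun x => |deriv f x| ^ 2 + 2 * t * (deriv f x * deriv g x)) s :=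
    i1.add i2
  rw [kineticOn, kineticOn, kineticOn, ← integral_const_mul, ← integral_const_mul,
    ← integral_add i1 i2, ← integral_add i12 i3]
  refine integral_congr_ae ?_
  filter_upwards [hf.ae_differentiableAt hs, (hg.const_smul t).ae_differentiableAt hs] with x h1 h2
  rw [deriv_add h1 h2, deriv_smul_eq]
  simp only [sq_abs, Pi.smul_apply, smul_eq_mul]
  ring

theorem sexticOn_add_smul (hs : IsEdge s) (hf : MemH1On s f) (hg : MemH1On s g) (t : ℝ) :
    sexticOn s (f + t • g) =
      ∑ k ∈ Finset.range 7,
        t ^ (6 - k) * ((Nat.choose 6 k) * ∫ x in s, f x ^ k * g x ^ (6 - k)) := by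
  have hi : ∀ k ∈ Finset.range 7, IntegrableOn
      (fun x => t ^ (6 - k) * ((Nat.choose 6 k) * (f x ^ k * g x ^ (6 - k)))) s := fun k hk =>
    ((hf.integrableOn_pow_mul_pow hs hg (by have := Finset.mem_range.1 hk; omega)).const_mul
      _).const_mul _
  simp only [← integral_const_mul]
  rw [sexticOn, ← integral_finsetSum _ hi]
  congr 1
  funext x
  rw [Even.pow_abs (by decide), Pi.add_apply, Pi.smul_apply, smul_eq_mul, add_pow]
  refine Finset.sum_congr rfl fun k _ => ?_
  rw [mul_pow]
  ring

theorem abs_integral_mul_le (hf : MemH1On s f) (hg : MemH1On s g) :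
    |∫ x in s, f x * g x| ≤ √(massOn s f) * √(massOn s g) := by
  rw [← Real.sqrt_mul (massOn_nonneg _ _)]
  apply Real.abs_le_sqrt
  simpa only [massOn, sq_abs] using sq_integral_mul_le hf.memLp hg.memLp

theorem abs_integral_deriv_mul_le (hf : MemH1On s f) (hg : MemH1On s g) :
    |∫ x in s, deriv f x * deriv g x| ≤ √(kineticOn s f) * √(kineticOn s g) := by
  rw [← Real.sqrt_mul (kineticOn_nonneg _ _)]
  apply Real.abs_le_sqrt
  simpa only [kineticOn, sq_abs] using sq_integral_mul_le hf.memLp_deriv hg.memLp_deriv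

end Expansion

/-! ### `H¹(G)` as a vector space, and the graph integrals along a line -/

namespace MetricGraph

variable {V B L : Type*}

section LinearStructure

variable {G : MetricGraph V B L} {u v : B ⊕ L → ℝ → ℝ}

theorem add_mem_H1 (hu : u ∈ G.H1) (hv : v ∈ G.H1) : u + v ∈ G.H1 := by
  obtain ⟨hu1, h, hu2, hu3⟩ := hu
  obtain ⟨hv1, k, hv2, hv3⟩ := hv
  exact ⟨fun e => (hu1 e).add (G.isEdge e) (hv1 e), h + k,
    fun b => ⟨by simp [(hu2 b).1, (hv2 b).1], by simp [(hu2 b).2, (hv2 b).2]⟩,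
    fun l => by simp [hu3 l, hv3 l]⟩

theorem smul_mem_H1 (hu : u ∈ G.H1) (c : ℝ) : c • u ∈ G.H1 := by
  obtain ⟨hu1, h, hu2, hu3⟩ := hu
  exact ⟨fun e => (hu1 e).const_smul c, c • h,
    fun b => ⟨by simp [(hu2 b).1], by simp [(hu2 b).2]⟩, fun l => by simp [hu3 l]⟩

theorem sub_mem_H1 (hu : u ∈ G.H1) (hv : v ∈ G.H1) : u - v ∈ G.H1 := by
  simpa [sub_eq_add_neg] using add_mem_H1 hu (smul_mem_H1 hv (-1))

end LinearStructure

variable [Fintype B] [Fintype L] (G : MetricGraph V B L)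

theorem mass_smul (c : ℝ) (u : B ⊕ L → ℝ → ℝ) : G.mass (c • u) = c ^ 2 * G.mass u := by
  simp only [mass_eq, Pi.smul_apply (f := u), massOn_smul, Finset.mul_sum]

theorem kinetic_smul (c : ℝ) (u : B ⊕ L → ℝ → ℝ) : G.kinetic (c • u) = c ^ 2 * G.kinetic u := by
  simp only [kinetic_eq, Pi.smul_apply (f := u), kineticOn_smul, Finset.mul_sum]

theorem sextic_smul (c : ℝ) (u : B ⊕ L → ℝ → ℝ) : G.sextic (c • u) = c ^ 6 * G.sextic u := by
  simp only [sextic_eq, Pi.smul_apply (f := u), sexticOn_smul, Finset.mul_sum]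

variable {G} {u v : B ⊕ L → ℝ → ℝ}

theorem mass_add_smul (hu : u ∈ G.H1) (hv : v ∈ G.H1) (t : ℝ) : G.mass (u + t • v) =
    G.mass u + 2 * t * G.integral (fun e x => u e x * v e x) + t ^ 2 * G.mass v := by
  simp only [mass_eq, integral, Finset.mul_sum, ← Finset.sum_add_distrib]
  exact Finset.sum_congr rfl fun e _ => massOn_add_smul (hu.1 e) (hv.1 e) t

theorem kinetic_add_smul (hu : u ∈ G.H1) (hv : v ∈ G.H1) (t : ℝ) : G.kinetic (u + t • v) =
    G.kinetic u + 2 * t * G.integral (fun e x => deriv (u e) x * deriv (v e) x) +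
      t ^ 2 * G.kinetic v := by
  simp only [kinetic_eq, integral, Finset.mul_sum, ← Finset.sum_add_distrib]
  exact Finset.sum_congr rfl fun e _ => kineticOn_add_smul (G.isEdge e) (hu.1 e) (hv.1 e) t

/-- Along a line the sextic term is a polynomial in `t`. -/
theorem differentiable_sextic_add_smul (hu : u ∈ G.H1) (hv : v ∈ G.H1) :
    Differentiable ℝ fun t : ℝ => G.sextic (u + t • v) := by
  have e : (fun t : ℝ => G.sextic (u + t • v)) = fun t : ℝ => ∑ e, ∑ k ∈ Finset.range 7,
      t ^ (6 - k) * ((Nat.choose 6 k) * ∫ x in G.edge e, u e x ^ k * v e x ^ (6 - k)) := by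
    funext t
    exact Finset.sum_congr rfl fun e _ => sexticOn_add_smul (G.isEdge e) (hu.1 e) (hv.1 e) t
  rw [e]
  fun_prop

theorem differentiable_kinetic_add_smul (hu : u ∈ G.H1) (hv : v ∈ G.H1) :
    Differentiable ℝ fun t : ℝ => G.kinetic (u + t • v) := by
  simp only [kinetic_add_smul hu hv]
  fun_prop

/-! ### Local minimizers are critical points -/

theorem h1Norm_smul_add_smul_le (hu : u ∈ G.H1) (hv : v ∈ G.H1) (a b : ℝ) :
    G.h1Norm (a • u + b • v) ≤ |a| * G.h1Norm u + |b| * G.h1Norm v := by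
  have hmk : ∀ w, 0 ≤ G.mass w + G.kinetic w := fun w =>
    add_nonneg (G.mass_nonneg w) (G.kinetic_nonneg w)
  have hcs : ∀ p q : B ⊕ L → ℝ → ℝ, p ∈ G.H1 → q ∈ G.H1 → G.h1Norm (p + q) ≤
      G.h1Norm p + G.h1Norm q := by
    intro p q hp hq
    have hm := mass_add_smul hp hq
    have hk := kinetic_add_smul hp hq
    set I := G.integral (fun e x => p e x * q e x)
    set J := G.integral (fun e x => deriv (p e) x * deriv (q e) x)
    have hquad : ∀ t : ℝ, 0 ≤ (G.mass q + G.kinetic q) * (t * t) + (2 * (I + J)) * t +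
        (G.mass p + G.kinetic p) := by
      intro t
      have := hmk (p + t • q)
      rw [hm, hk] at this
      linarith
    have hd := discrim_le_zero hquad
    rw [discrim] at hd
    have hIJ : I + J ≤ G.h1Norm p * G.h1Norm q := by
      rw [h1Norm, h1Norm, ← Real.sqrt_mul (hmk p)]
      exact Real.le_sqrt_of_sq_le (by linarith)
    have hm1 := hm 1
    have hk1 := hk 1
    rw [one_smul] at hm1 hk1
    have hp2 : G.h1Norm p ^ 2 = G.mass p + G.kinetic p := Real.sq_sqrt (hmk p)
    have hq2 : G.h1Norm q ^ 2 = G.mass q + G.kinetic q := Real.sq_sqrt (hmk q)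
    refine Real.sqrt_le_iff.2 ⟨add_nonneg (Real.sqrt_nonneg _) (Real.sqrt_nonneg _), ?_⟩
    rw [hm1, hk1]
    nlinarith
  have hsm : ∀ (c : ℝ) (p : B ⊕ L → ℝ → ℝ), G.h1Norm (c • p) = |c| * G.h1Norm p := by
    intro c p
    rw [h1Norm, h1Norm, mass_smul, kinetic_smul, ← mul_add, Real.sqrt_mul (sq_nonneg c),
      Real.sqrt_sq_eq_abs]
  rw [← hsm, ← hsm]
  exact hcs _ _ (smul_mem_H1 hu a) (smul_mem_H1 hv b)

/-- The line `u + t • φ` leaves the constraint only at second order, since orthogonality removes the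
linear term of the mass. Renormalizing therefore does not change the derivative of the energy at
`0`, and Fermat's rule applies to the renormalized curve. -/
theorem IsLocalMinimizer.isCriticalPoint {μ : ℝ} (hμ : 0 < μ) (h : G.IsLocalMinimizer μ u) :
    G.IsCriticalPoint μ u := by
  obtain ⟨⟨hu, hmass⟩, ε, hε, hmin⟩ := h
  refine ⟨⟨hu, hmass⟩, fun φ hφ horth => ?_⟩
  have hT := (differentiable_kinetic_add_smul hu hφ).differentiableAt (x := 0) |>.hasDerivAt
  have hS := (differentiable_sextic_add_smul hu hφ).differentiableAt (x := 0) |>.hasDerivAt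
  set T' := deriv (fun t : ℝ => G.kinetic (u + t • φ)) 0
  set S' := deriv (fun t : ℝ => G.sextic (u + t • φ)) 0
  have hE : HasDerivAt (fun t : ℝ => G.energy (u + t • φ)) (1 / 2 * T' - 1 / 6 * S') 0 :=
    (hT.const_mul _).sub (hS.const_mul _)
  have hmt : ∀ t : ℝ, G.mass (u + t • φ) = μ + t ^ 2 * G.mass φ := fun t => by
    rw [mass_add_smul hu hφ, horth, hmass]; ring
  have hpos : ∀ t : ℝ, 0 < μ + t ^ 2 * G.mass φ := fun t =>
    add_pos_of_pos_of_nonneg hμ (mul_nonneg (sq_nonneg _) (G.mass_nonneg _))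
  set ν : ℝ → ℝ := fun t => μ / (μ + t ^ 2 * G.mass φ) with hν
  have hν0 : ν 0 = 1 := by simp [hν, hμ.ne']
  have hνpos : ∀ t, 0 < ν t := fun t => div_pos hμ (hpos t)
  have hνd : HasDerivAt ν 0 0 := by
    have h1 : HasDerivAt (fun t : ℝ => μ + t ^ 2 * G.mass φ) 0 0 := by
      simpa using ((hasDerivAt_pow 2 (0 : ℝ)).mul_const (G.mass φ)).const_add μ
    convert! (hasDerivAt_const (0 : ℝ) μ).div h1 (hpos 0).ne' using 1
    simp
  set F : ℝ → ℝ := fun t => 1 / 2 * (ν t * G.kinetic (u + t • φ)) -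
    1 / 6 * (ν t ^ 3 * G.sextic (u + t • φ)) with hF
  have hFd : HasDerivAt F (1 / 2 * T' - 1 / 6 * S') 0 := by
    have h1 := ((hνd.mul hT).const_mul (1 / 2)).sub (((hνd.pow 3).mul hS).const_mul (1 / 6))
    convert! h1 using 1
    simp [hν0]
  have hFE : ∀ t, F t = G.energy (√(ν t) • (u + t • φ)) := by
    intro t
    rw [energy, kinetic_smul, sextic_smul, show √(ν t) ^ 6 = (√(ν t) ^ 2) ^ 3 by ring,
      Real.sq_sqrt (hνpos t).le]
  have hclose : ∀ᶠ t in 𝓝 (0 : ℝ), G.h1Norm (√(ν t) • (u + t • φ) - u) < ε := by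
    have h1 : Tendsto (fun t => |√(ν t) - 1| * G.h1Norm u + |√(ν t) * t| * G.h1Norm φ) (𝓝 0)
        (𝓝 0) := by
      have hs : ContinuousAt (fun t => √(ν t)) 0 := hνd.continuousAt.sqrt
      have h2 : ContinuousAt (fun t => |√(ν t) - 1| * G.h1Norm u + |√(ν t) * t| * G.h1Norm φ) 0 :=
        ((hs.sub continuousAt_const).abs.mul continuousAt_const).add
          ((hs.mul continuousAt_id).abs.mul continuousAt_const)
      have h3 := h2.tendsto
      simpa [hν0] using h3
    filter_upwards [h1.eventually_lt_const hε] with t ht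
    have e : √(ν t) • (u + t • φ) - u = (√(ν t) - 1) • u + (√(ν t) * t) • φ := by module
    rw [e]
    exact (h1Norm_smul_add_smul_le hu hφ _ _).trans_lt ht
  have hloc : IsLocalMin F 0 := by
    filter_upwards [hclose] with t ht
    have h0 : F 0 = G.energy u := by simp [hFE, hν0]
    rw [h0, hFE]
    refine hmin _ ⟨smul_mem_H1 (add_mem_H1 hu (smul_mem_H1 hφ t)) _, ?_⟩ ht
    rw [mass_smul, hmt, Real.sq_sqrt (hνpos t).le]
    exact div_mul_cancel₀ _ (hpos t).ne'
  rwa [hloc.hasDerivAt_eq_zero hFd] at hE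

/-! ### The minimization problem -/

variable (G) in
/-- Functions of mass `μ` with kinetic term at least `K`, at most a third of the critical mass of
the line on every half-line. -/
def confined (μ K : ℝ) : Set (B ⊕ L → ℝ → ℝ) :=
  {u | u ∈ G.H1Mass μ ∧ (∀ l, massOn (Ici 0) (u (Sum.inr l)) ≤ lineMass / 3) ∧ K ≤ G.kinetic u}

/-- Below the critical mass the energy controls the kinetic term. -/
theorem kinetic_le_energy (hG : G.criticalMass = lineMass) (hu : u ∈ G.H1) :
    (lineMass ^ 2 - G.mass u ^ 2) * G.kinetic u ≤ 2 * lineMass ^ 2 * G.energy u := by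
  have h := G.gagliardoNirenberg (by rw [hG]; exact lineMass_pos) hu
  rw [hG] at h
  unfold energy
  linarith

theorem energy_nonneg (hG : G.criticalMass = lineMass) (hu : u ∈ G.H1)
    (hm : G.mass u ≤ lineMass) : 0 ≤ G.energy u := by
  have h := kinetic_le_energy hG hu
  have h1 : G.mass u ^ 2 ≤ lineMass ^ 2 := pow_le_pow_left₀ (G.mass_nonneg u) hm 2
  have h2 := mul_nonneg (sub_nonneg.2 h1) (G.kinetic_nonneg u)
  have h3 := h2.trans h
  have h4 : 0 < 2 * lineMass ^ 2 := by have := lineMass_pos; positivity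
  exact nonneg_of_mul_nonneg_right h3 h4

theorem mass_le_of_weakLimit {F : ℕ → B ⊕ L → ℝ → ℝ} {w : B ⊕ L → ℝ → ℝ} {C : ℝ}
    (hlim : ∀ e, WeakLimit (G.edge e) (fun n => F n e) (w e)) (hC : ∀ n, G.mass (F n) ≤ C) :
    G.mass w ≤ C := by
  have hcut : ∀ R e, G.cutEdge R e ⊆ G.edge e := by
    rintro R (b | l)
    · exact le_rfl
    · exact Icc_subset_Ici_self
  have key : ∀ R, ∑ e, massOn (G.cutEdge R e) (w e) ≤ C := by
    intro R
    have ht : Tendsto (fun n => ∑ e, massOn (G.cutEdge R e) (F n e)) atTop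
        (𝓝 (∑ e, massOn (G.cutEdge R e) (w e))) := by
      refine tendsto_finsetSum Finset.univ fun e _ => ?_
      rcases e with b | l
      · exact (hlim (Sum.inl b)).tendsto_integral_pow (G.isEdge _) le_rfl 2
      · exact (hlim (Sum.inr l)).tendsto_integral_pow (G.isEdge _) Icc_subset_Ici_self 2
    refine le_of_tendsto' ht fun n => le_trans ?_ (hC n)
    exact Finset.sum_le_sum fun e _ => setIntegral_mono_set ((hlim e).mem n).integrableOn_sq
        (Eventually.of_forall fun x => by positivity) (Eventually.of_forall (hcut R e))
  have ht : Tendsto (fun R => ∑ e, massOn (G.cutEdge R e) (w e)) atTop (𝓝 (G.mass w)) := by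
    refine tendsto_finsetSum Finset.univ fun e _ => ?_
    rcases e with b | l
    · exact tendsto_const_nhds
    · exact tendsto_setIntegral_Icc_atTop (hlim (Sum.inr l)).mem_limit.integrableOn_sq
  exact le_of_tendsto' ht key

/-- If some function in the confined set has small energy, then the infimum of the energy on this
set is attained. -/
theorem exists_minimizer [DecidableEq L] (hG : G.criticalMass = lineMass)
    (hremove : ∀ l : L, (G.removeHalfLine l).criticalMass = lineMass) {K : ℝ} (hK : 0 < K)
    (hbar : ∀ u ∈ G.H1, G.mass u ≤ lineMass →
      (∀ l, massOn (Ici 0) (u (Sum.inr l)) ≤ lineMass / 3) → G.kinetic u ≤ K →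
      G.sextic u ≤ 3 / 2 * G.kinetic u) {μ : ℝ} (hμm : μ < lineMass)
    {w₀ : B ⊕ L → ℝ → ℝ} (hw₀ : w₀ ∈ G.confined μ K) (hE₀ : G.energy w₀ < K / 4) :
    ∃ u ∈ G.confined μ K, ∀ w ∈ G.confined μ K, G.energy u ≤ G.energy w := by
  set I := sInf (G.energy '' G.confined μ K) with hI
  have hne : (G.energy '' G.confined μ K).Nonempty := ⟨_, w₀, hw₀, rfl⟩
  have hbdd : BddBelow (G.energy '' G.confined μ K) := by
    refine ⟨0, ?_⟩
    rintro _ ⟨v, hv, rfl⟩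
    exact energy_nonneg hG hv.1.1 (by rw [hv.1.2]; exact hμm.le)
  have hIle : ∀ v ∈ G.confined μ K, I ≤ G.energy v := fun v hv => csInf_le hbdd ⟨v, hv, rfl⟩
  have hIK : I < K / 4 := (hIle w₀ hw₀).trans_lt hE₀
  have hμ0 : 0 ≤ μ := by rw [← hw₀.1.2]; exact G.mass_nonneg _
  obtain ⟨E, -, hEI, hEmem⟩ := exists_seq_tendsto_sInf hne hbdd
  choose F hF hFE using hEmem
  obtain ⟨C, hC⟩ := hEI.bddAbove_range
  have hgap : 0 < lineMass ^ 2 - μ ^ 2 := sub_pos.2 (pow_lt_pow_left₀ hμm hμ0 two_ne_zero)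
  have hT : ∀ n, G.kinetic (F n) ≤ 2 * lineMass ^ 2 * C / (lineMass ^ 2 - μ ^ 2) := by
    intro n
    rw [le_div_iff₀ hgap, mul_comm]
    have h1 := kinetic_le_energy hG (hF n).1.1
    rw [(hF n).1.2] at h1
    refine h1.trans ?_
    have h2 : G.energy (F n) ≤ C := by rw [hFE n]; exact hC ⟨n, rfl⟩
    gcongr
  obtain ⟨φ, hφ, w, hw, hlim⟩ := G.exists_weakLimit (fun n => (hF n).1.1)
    (fun n => (hF n).1.2.le) hT
  have hml : ∀ l, massOn (Ici 0) (w (Sum.inr l)) ≤ lineMass / 3 := fun l =>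
    (hlim (Sum.inr l)).massOn_le isEdge_Ici fun n => (hF (φ n)).2.1 l
  have hmw : G.mass w ≤ μ := mass_le_of_weakLimit hlim fun n => (hF (φ n)).1.2.le
  have hEw : G.energy w ≤ I := by
    have := G.energy_sub_le_of_weakLimit (θ := 0) (E := fun n => E (φ n)) (by norm_num) hlim
      (fun n => (hF (φ n)).2.1) (fun n => by rw [hFE]; simp) (hEI.comp hφ.tendsto_atTop)
    simpa using this
  -- Along the sequence `T ≥ K`, so `E - 5 / 18 * T` is at most `E - 5 / 18 * K`, and `θ = 5 / 18`
  -- is still allowed for lower semicontinuity.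
  have hEw' : G.energy w - 5 / 18 * G.kinetic w ≤ I - 5 / 18 * K := by
    refine G.energy_sub_le_of_weakLimit (E := fun n => E (φ n) - 5 / 18 * K) le_rfl hlim
      (fun n => (hF (φ n)).2.1) (fun n => ?_)
      ((hEI.comp hφ.tendsto_atTop).sub_const (5 / 18 * K))
    rw [hFE]
    linarith [(hF (φ n)).2.2]
  -- If `T < K`, the barrier gives `E ≥ T / 4`, so `-T / 36 ≤ I - 5 / 18 * K < -K / 36`, which
  -- contradicts `T < K`.
  have hTw : K ≤ G.kinetic w := by
    by_contra hlt
    have h1 := hbar w hw (hmw.trans hμm.le) hml (not_le.1 hlt).le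
    have h2 : G.energy w = 1 / 2 * G.kinetic w - 1 / 6 * G.sextic w := rfl
    linarith [not_le.1 hlt]
  -- From `E ≤ I < K / 4 ≤ T / 4`.
  have hST : 3 / 2 * G.kinetic w < G.sextic w := by
    have h2 : G.energy w = 1 / 2 * G.kinetic w - 1 / 6 * G.sextic w := rfl
    linarith
  have hmw0 : 0 < G.mass w := by
    refine (G.mass_nonneg w).lt_of_ne fun h0 => ?_
    have h1 := G.gagliardoNirenberg (by rw [hG]; exact lineMass_pos) hw
    rw [← h0, hG] at h1
    have h2 := mul_pos (pow_pos lineMass_pos 2) (show 0 < G.sextic w by linarith)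
    have h3 : (3 : ℝ) * 0 ^ 2 * G.kinetic w = 0 := by ring
    linarith
  have hscale : ∀ q : ℝ, 0 < q → ∀ l, massOn (Ici 0) ((√q • w) (Sum.inr l)) =
      q * massOn (Ici 0) (w (Sum.inr l)) := fun q hq l => by
    rw [Pi.smul_apply (f := w), massOn_smul, Real.sq_sqrt hq.le]
  have hmass : G.mass w = μ := by
    by_contra hne
    have hlt : G.mass w < μ := lt_of_le_of_ne hmw hne
    set p := μ / G.mass w with hp
    have hp1 : 1 < p := (one_lt_div hmw0).2 hlt
    have hp0 : 0 < p := by linarith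
    have hpm : p * G.mass w = μ := div_mul_cancel₀ _ hmw0.ne'
    -- If scaling the mass up to `μ` overfilled a half-line, some intermediate factor `q ≥ 1` would
    -- put exactly `lineMass / 3` on it. Then `q ^ 3 * S ≤ 4 / 3 * q * T`, which is incompatible
    -- with `S > 3 / 2 * T`.
    have hall : ∀ l, p * massOn (Ici 0) (w (Sum.inr l)) ≤ lineMass / 3 := by
      intro l
      by_contra hl
      push Not at hl
      have hm0 : 0 < massOn (Ici 0) (w (Sum.inr l)) := by
        by_contra hc
        have := mul_nonpos_of_nonneg_of_nonpos hp0.le (not_lt.1 hc)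
        linarith [lineMass_pos]
      set q := lineMass / 3 / massOn (Ici 0) (w (Sum.inr l)) with hq
      have hq1 : 1 ≤ q := (one_le_div hm0).2 (hml l)
      have hq0 : 0 < q := by linarith
      have hqp : q < p := (div_lt_iff₀ hm0).2 hl
      have h1 := G.sextic_le_of_mass_eq_third (hremove l) (smul_mem_H1 hw (√q)) (by
        rw [mass_smul, Real.sq_sqrt hq0.le]
        have : q * G.mass w ≤ p * G.mass w := by gcongr
        linarith) (by
        rw [hscale q hq0, hq, div_mul_cancel₀ _ hm0.ne'])
      rw [sextic_smul, kinetic_smul, show √q ^ 6 = (√q ^ 2) ^ 3 by ring,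
        Real.sq_sqrt hq0.le] at h1
      have h2 : q * G.sextic w ≤ q ^ 3 * G.sextic w := by
        have h3 : q ≤ q ^ 3 := le_self_pow₀ hq1 (by norm_num)
        have := G.sextic_nonneg w
        gcongr
      have h4 := mul_lt_mul_of_pos_left hST hq0
      have h5 := mul_nonneg hq0.le (G.kinetic_nonneg w)
      linarith
    have hmem : √p • w ∈ G.confined μ K := by
      refine ⟨⟨smul_mem_H1 hw _, ?_⟩, fun l => ?_, ?_⟩
      · rw [mass_smul, Real.sq_sqrt hp0.le, hpm]
      · rw [hscale p hp0]; exact hall l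
      · rw [kinetic_smul, Real.sq_sqrt hp0.le]
        exact hTw.trans (le_mul_of_one_le_left (G.kinetic_nonneg w) hp1.le)
    -- The scaled function is a competitor, but its energy exceeds that of `w` by `(p - 1) * T / 2 -
    -- (p ^ 3 - 1) * S / 6 ≤ (p - 1) * (T - S) / 2 < 0`.
    have h1 := hIle _ hmem
    rw [energy, kinetic_smul, sextic_smul, show √p ^ 6 = (√p ^ 2) ^ 3 by ring,
      Real.sq_sqrt hp0.le] at h1
    have h2 : G.energy w = 1 / 2 * G.kinetic w - 1 / 6 * G.sextic w := rfl
    have h3 : p ^ 3 - 1 = (p - 1) * (p ^ 2 + p + 1) := by ring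
    have h4 : 3 * (p - 1) ≤ p ^ 3 - 1 := by
      rw [h3, mul_comm]
      exact mul_le_mul_of_nonneg_left (by nlinarith) (sub_pos.2 hp1).le
    have h5 := mul_le_mul_of_nonneg_right h4 (G.sextic_nonneg w)
    have h6 := mul_lt_mul_of_pos_left hST (sub_pos.2 hp1)
    have h7 := mul_nonneg (sub_pos.2 hp1).le (G.kinetic_nonneg w)
    linarith
  exact ⟨w, ⟨⟨hw, hmass⟩, hml, hTw⟩, fun v hv => hEw.trans (hIle v hv)⟩

/-- A function in the interior of the confined set has a neighbourhood in `H¹_μ(G)` that is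
contained in the confined set. -/
theorem exists_ball_subset_confined {μ K : ℝ} (hu : u ∈ G.H1Mass μ)
    (hl : ∀ l, massOn (Ici 0) (u (Sum.inr l)) < lineMass / 3) (hT : K < G.kinetic u) :
    ∃ ε : ℝ, 0 < ε ∧ ∀ w ∈ G.H1Mass μ, G.h1Norm (w - u) < ε → w ∈ G.confined μ K := by
  -- By Cauchy-Schwarz, a perturbation of norm less than `ε` adds at most `2 * √M * ε + ε ^ 2` to
  -- the mass `M` of a half-line and removes at most `2 * √T * ε` from the kinetic term `T` of an
  -- edge.
  have ev1 : ∀ᶠ ε in 𝓝[>] (0 : ℝ), ∀ l, massOn (Ici 0) (u (Sum.inr l)) +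
      2 * (√(massOn (Ici 0) (u (Sum.inr l))) * ε) + ε ^ 2 < lineMass / 3 := by
    refine (eventually_all.2 fun l => ?_).filter_mono nhdsWithin_le_nhds
    have hc : Continuous fun ε : ℝ => massOn (Ici 0) (u (Sum.inr l)) +
      2 * (√(massOn (Ici 0) (u (Sum.inr l))) * ε) + ε ^ 2 := by fun_prop
    refine (hc.tendsto 0).eventually_lt_const ?_
    simpa using hl l
  have ev2 : ∀ᶠ ε in 𝓝[>] (0 : ℝ),
      K < G.kinetic u - 2 * ((∑ e, √(kineticOn (G.edge e) (u e))) * ε) := by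
    refine Eventually.filter_mono nhdsWithin_le_nhds ?_
    have hc : Continuous fun ε : ℝ =>
      G.kinetic u - 2 * ((∑ e, √(kineticOn (G.edge e) (u e))) * ε) := by fun_prop
    refine (hc.tendsto 0).eventually_const_lt ?_
    simpa using hT
  obtain ⟨ε, h1, h2, hε⟩ := (ev1.and (ev2.and self_mem_nhdsWithin)).exists
  have hε : 0 < ε := hε
  refine ⟨ε, hε, fun w hw hclose => ?_⟩
  have hv := sub_mem_H1 hw.1 hu.1
  set v := w - u with hvdef
  have hwv : ∀ e, w e = u e + (1 : ℝ) • v e := fun e => by simp [hvdef]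
  have hsum : G.mass v + G.kinetic v < ε ^ 2 := (Real.sqrt_lt' hε).1 hclose
  have hmv : ∀ e, √(massOn (G.edge e) (v e)) ≤ ε := fun e => by
    refine Real.sqrt_le_iff.2 ⟨hε.le, ?_⟩
    linarith [G.massOn_le_mass v e, G.kinetic_nonneg v]
  have hkv : ∀ e, √(kineticOn (G.edge e) (v e)) ≤ ε := fun e => by
    refine Real.sqrt_le_iff.2 ⟨hε.le, ?_⟩
    linarith [G.kineticOn_le_kinetic v e, G.mass_nonneg v]
  refine ⟨hw, fun l => ?_, ?_⟩
  · have e1 := massOn_add_smul (hu.1.1 (Sum.inr l)) (hv.1 (Sum.inr l)) 1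
    rw [← hwv] at e1
    have e2 := abs_integral_mul_le (hu.1.1 (Sum.inr l)) (hv.1 (Sum.inr l))
    have e3 := mul_le_mul_of_nonneg_left (hmv (Sum.inr l))
      (Real.sqrt_nonneg (massOn (G.edge (Sum.inr l)) (u (Sum.inr l))))
    have e4 := G.massOn_le_mass v (Sum.inr l)
    have e5 := (abs_le.1 e2).2
    have e6 := h1 l
    change massOn (G.edge (Sum.inr l)) _ ≤ _
    change massOn (G.edge (Sum.inr l)) _ + 2 * (√(massOn (G.edge (Sum.inr l)) _) * ε) + _ < _ at e6
    linarith [G.kinetic_nonneg v]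
  · have key : ∀ e, kineticOn (G.edge e) (u e) - 2 * (√(kineticOn (G.edge e) (u e)) * ε) ≤
        kineticOn (G.edge e) (w e) := by
      intro e
      have e1 := kineticOn_add_smul (G.isEdge e) (hu.1.1 e) (hv.1 e) 1
      rw [← hwv] at e1
      have e2 := abs_integral_deriv_mul_le (hu.1.1 e) (hv.1 e)
      have e3 := mul_le_mul_of_nonneg_left (hkv e) (Real.sqrt_nonneg (kineticOn (G.edge e) (u e)))
      have e5 := (abs_le.1 e2).1
      have e6 := kineticOn_nonneg (G.edge e) (v e)
      linarith
    have hs := Finset.sum_le_sum fun e (_ : e ∈ Finset.univ) => key e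
    rw [Finset.sum_sub_distrib, ← Finset.mul_sum, ← Finset.sum_mul, ← kinetic_eq,
      ← kinetic_eq] at hs
    linarith

variable (G) in
/-- A function on the bounded edge `b` that vanishes at both endpoints extends by zero to the
graph. -/
theorem exists_mem_confined_of_edge (b : B) {w : ℝ → ℝ} {μ K : ℝ}
    (hw : MemH1On (Icc 0 (G.len b)) w) (h0 : w 0 = 0) (h1 : w (G.len b) = 0)
    (hm : massOn (Icc 0 (G.len b)) w = μ) (hK : K ≤ kineticOn (Icc 0 (G.len b)) w) :
    ∃ u ∈ G.confined μ K, G.energy u =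
      1 / 2 * kineticOn (Icc 0 (G.len b)) w - 1 / 6 * sexticOn (Icc 0 (G.len b)) w := by
  classical
  set u : B ⊕ L → ℝ → ℝ := fun e => if e = Sum.inl b then w else 0 with hu
  have hub : u (Sum.inl b) = w := if_pos rfl
  have hue : ∀ e, e ≠ Sum.inl b → u e = 0 := fun e he => if_neg he
  have hmass : G.mass u = μ := by
    rw [mass_eq, Fintype.sum_eq_single (Sum.inl b) fun e he => by simp [hue e he, massOn], hub]
    exact hm
  have hkin : G.kinetic u = kineticOn (Icc 0 (G.len b)) w := by
    rw [kinetic_eq, Fintype.sum_eq_single (Sum.inl b) fun e he => by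
      simp [hue e he, kineticOn], hub]
    rfl
  have hsex : G.sextic u = sexticOn (Icc 0 (G.len b)) w := by
    rw [sextic_eq, Fintype.sum_eq_single (Sum.inl b) fun e he => by
      simp [hue e he, sexticOn], hub]
    rfl
  refine ⟨u, ⟨⟨⟨fun e => ?_, fun _ => 0, fun b' => ?_, fun l => ?_⟩, hmass⟩, fun l => ?_, ?_⟩, ?_⟩
  · by_cases he : e = Sum.inl b
    · subst he; rw [hub]; exact hw
    · rw [hue e he]
      exact MemH1On.of_contDiff contDiff_const MemLp.zero (by simp)
  · by_cases he : b' = b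
    · subst he; rw [hub]; exact ⟨h0, h1⟩
    · rw [hue _ (by simpa using he)]; exact ⟨rfl, rfl⟩
  · rw [hue _ (by simp)]; rfl
  · rw [hue _ (by simp)]
    simpa [massOn] using (div_pos lineMass_pos three_pos).le
  · rw [hkin]; exact hK
  · rw [energy, hkin, hsex]

end MetricGraph

/-! ### The minimizer lies in the interior of the confined set -/

theorem proposition6 {V B L : Type*} [Finite V] [Fintype B] [Fintype L] [DecidableEq L]
    (G : MetricGraph V B L) (hconn : G.Connected)
    (hnoncompact : Nonempty L) (hcore : Nonempty B)
    (hG : G.criticalMass = MetricGraph.realLine.criticalMass)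
    (hremove : ∀ l : L,
      (G.removeHalfLine l).criticalMass = MetricGraph.realLine.criticalMass) :
    ∃ μbar : ℝ, 0 < μbar ∧ μbar < MetricGraph.realLine.criticalMass ∧
      ∀ μ : ℝ, μbar < μ → μ < MetricGraph.realLine.criticalMass →
        ∃ u : B ⊕ L → ℝ → ℝ, G.IsCriticalPoint μ u ∧ G.IsLocalMinimizer μ u := by
  obtain ⟨b⟩ := hcore
  obtain ⟨K, hK, hbar⟩ := G.exists_kinetic_barrier hconn hnoncompact hG
  obtain ⟨μ₀, hμ₀, hconc⟩ := (mem_nhdsLT_iff_exists_Ioo_subset' lineMass_pos).1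
    (exists_concentrated (G.len_pos b) hK)
  -- The threshold `μ₀` for concentrated functions may be nonpositive; the maximum with `lineMass /
  -- 2` makes `μbar` positive.
  refine ⟨max μ₀ (lineMass / 2), lt_max_of_lt_right (half_pos lineMass_pos),
    max_lt hμ₀ (half_lt_self lineMass_pos), fun μ hμ hμm => ?_⟩
  have hμ0 : 0 < μ := (half_pos lineMass_pos).trans ((le_max_right _ _).trans_lt hμ)
  obtain ⟨w, hw, hw0, hw1, hwm, hwK, hwE⟩ := hconc ⟨(le_max_left _ _).trans_lt hμ, hμm⟩
  obtain ⟨w₀, hw₀, hE₀⟩ := G.exists_mem_confined_of_edge b hw hw0 hw1 hwm hwK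
  have hE₀K : G.energy w₀ < K / 4 := by rw [hE₀]; exact hwE
  obtain ⟨u, hu, hmin⟩ := MetricGraph.exists_minimizer hG hremove hK hbar hμm hw₀ hE₀K
  have hEu : 1 / 2 * G.kinetic u - 1 / 6 * G.sextic u < K / 4 := (hmin w₀ hw₀).trans_lt hE₀K
  have hmass : G.mass u ≤ lineMass := by rw [hu.1.2]; exact hμm.le
  -- Equality on a half-line would give `E ≥ 5 / 18 * T ≥ 5 / 18 * K > K / 4`.
  have hl : ∀ l, massOn (Ici 0) (u (Sum.inr l)) < lineMass / 3 := by
    refine fun l => (hu.2.1 l).lt_of_ne fun heq => ?_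
    have := G.sextic_le_of_mass_eq_third (hremove l) hu.1.1 hmass heq
    linarith [hu.2.2]
  -- Equality would give `E ≥ T / 4 = K / 4` by the barrier.
  have hT : K < G.kinetic u := by
    refine hu.2.2.lt_of_ne fun heq => ?_
    have := hbar u hu.1.1 hmass hu.2.1 heq.ge
    linarith
  obtain ⟨ε, hε, hball⟩ := MetricGraph.exists_ball_subset_confined hu.1 hl hT
  have hloc : G.IsLocalMinimizer μ u :=
    ⟨hu.1, ε, hε, fun v hv hclose => hmin v (hball v hv hclose)⟩
  exact ⟨u, hloc.isCriticalPoint hμ0, hloc⟩
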